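/- Let $k$ be a commutative ring and let $\mathcal R$ be a DGA with many objects over $k$, that is, a small category enriched in unbounded chain complexes of $k$-modules. Let $\mathrm{Mod}\text{-}\mathcal R$ be the category of differential graded (left) $\mathcal R$-modules: an object $M$ consists of a chain complex of $k$-modules $M(x)$ for each object $x$ of $\mathcal R$, together with chain maps $\mathcal R(x,y)\otimes_k M(x)\to M(y)$ that are associative and unital; a morphism $M\to N$ is a family of chain maps $M(x)\to N(x)$ commuting with these actions. Then $\mathrm{Mod}\text{-}\mathcal R$ admits a model structure (the "doubly injective" one) in which - the weak equivalences are the objectwise quasi-isomorphisms, i.e. the morphisms $M\to N$ such that $H_*(M(x))\to H_*(N(x))$ is an isomorphism for every object $x$ of $\mathcal R$; - the cofibrations are the monomorphisms. This model structure is combinatorial: the category $\mathrm{Mod}\text{-}\mathcal R$ is locally presentable, and the model structure is cofibrantly generated, i.e. there are sets $I$ and $J$ of morphisms permitting the small object argument such that the trivial fibrations are the morphisms with the right lifting property with respect to $I$ and the fibrations are the morphisms with the right lifting property with respect to $J$. -/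

import Mathlib

open CategoryTheory CategoryTheory.Limits HomotopicalAlgebra

universe v u w

/-- A DGA with many objects over a commutative ring `k`, that is, a small category enriched in
(unbounded) chain complexes of `k`-modules. The differentials lower the degree by one. The chain
complex of morphisms from `x` to `y` is `Hom x y`, and `comp p q n h g f` is the composite `g ∘ f`
of a morphism `g : y ⟶ z` of degree `p` with a morphism `f : x ⟶ y` of degree `q`; its degree is
`n = p + q`. For one object this is a differential graded `k`-algebra. -/
structure DGCat (k : Type u) [CommRing k] where
  /-- the objects -/
  Obj : Type u
  /-- the complexes of morphisms -/
  Hom : Obj → Obj → ChainComplex (ModuleCat.{u} k) ℤ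
  /-- the identities, which have degree `0` -/
  id (x : Obj) : (Hom x x).X 0
  /-- the `k`-bilinear composition -/
  comp {x y z : Obj} (p q n : ℤ) (h : p + q = n) :
    (Hom y z).X p →ₗ[k] (Hom x y).X q →ₗ[k] (Hom x z).X n
  id_comp {x y : Obj} (q : ℤ) (f : (Hom x y).X q) :
    comp 0 q q (zero_add q) (id y) f = f
  comp_id {x y : Obj} (p : ℤ) (g : (Hom x y).X p) :
    comp p 0 p (add_zero p) g (id x) = g
  assoc {x y z t : Obj} (p q r pq qr n : ℤ) (h₁ : p + q = pq) (h₂ : q + r = qr)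
      (h₃ : pq + r = n) (h₄ : p + qr = n)
      (a : (Hom z t).X p) (b : (Hom y z).X q) (c : (Hom x y).X r) :
    comp pq r n h₃ (comp p q pq h₁ a b) c = comp p qr n h₄ a (comp q r qr h₂ b c)
  d_id (x : Obj) : (Hom x x).d 0 (-1) (id x) = 0
  /-- the Leibniz rule `d (g ∘ f) = dg ∘ f + (-1) ^ |g| g ∘ df` -/
  d_comp {x y z : Obj} (p q n p' q' n' : ℤ) (h : p + q = n)
      (hp : p' + 1 = p) (hq : q' + 1 = q) (hn : n' + 1 = n)
      (g : (Hom y z).X p) (f : (Hom x y).X q) :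
    (Hom x z).d n n' (comp p q n h g f) =
      comp p' q n' (by omega) ((Hom y z).d p p' g) f +
        p.negOnePow • comp p q' n' (by omega) g ((Hom x y).d q q' f)

/-- A (left) DG module over a DGA with many objects `R`: a covariant functor from `R` to chain
complexes of `k`-modules, enriched over chain complexes. It consists of a chain complex `cx x` for
every object `x` and of an associative and unital `k`-bilinear action
`Hom x y ⊗ cx x ⟶ cx y`, which is additive on degrees and obeys the Leibniz rule. -/
structure DGModule {k : Type u} [CommRing k] (R : DGCat.{u} k) where
  /-- the value at an object -/
  cx : R.Obj → ChainComplex (ModuleCat.{u} k) ℤ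
  /-- the action of the morphisms of `R` -/
  act {x y : R.Obj} (p q n : ℤ) (h : p + q = n) :
    (R.Hom x y).X p →ₗ[k] (cx x).X q →ₗ[k] (cx y).X n
  id_act {x : R.Obj} (q : ℤ) (m : (cx x).X q) :
    act 0 q q (zero_add q) (R.id x) m = m
  comp_act {x y z : R.Obj} (p q r pq qr n : ℤ) (h₁ : p + q = pq) (h₂ : q + r = qr)
      (h₃ : pq + r = n) (h₄ : p + qr = n)
      (g : (R.Hom y z).X p) (f : (R.Hom x y).X q) (m : (cx x).X r) :
    act pq r n h₃ (R.comp p q pq h₁ g f) m = act p qr n h₄ g (act q r qr h₂ f m)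
  /-- the Leibniz rule `d (f m) = (df) m + (-1) ^ |f| f (dm)` -/
  d_act {x y : R.Obj} (p q n p' q' n' : ℤ) (h : p + q = n)
      (hp : p' + 1 = p) (hq : q' + 1 = q) (hn : n' + 1 = n)
      (f : (R.Hom x y).X p) (m : (cx x).X q) :
    (cx y).d n n' (act p q n h f m) =
      act p' q n' (by omega) ((R.Hom x y).d p p' f) m +
        p.negOnePow • act p q' n' (by omega) f ((cx x).d q q' m)

namespace DGModule

variable {k : Type u} [CommRing k] {R : DGCat.{u} k}

/-- A morphism of DG modules: chain maps of degree `0`, one for every object, that commute with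
the action of `R`. -/
@[ext]
structure Hom (M N : DGModule R) where
  /-- the chain map at an object -/
  app (x : R.Obj) : M.cx x ⟶ N.cx x
  app_act {x y : R.Obj} (p q n : ℤ) (h : p + q = n)
      (f : (R.Hom x y).X p) (m : (M.cx x).X q) :
    (app y).f n (M.act p q n h f m) = N.act p q n h f ((app x).f q m)

/-- The category of DG modules over `R`. -/
instance : Category (DGModule R) where
  Hom M N := Hom M N
  id M := { app := fun x => 𝟙 (M.cx x), app_act := by intros; simp }
  comp φ ψ :=
    { app := fun x => φ.app x ≫ ψ.app x
      app_act := by intros; simp [φ.app_act, ψ.app_act] }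

variable (R) in
/-- The objectwise quasi-isomorphisms: the morphisms of DG modules that induce an isomorphism in
homology, in every degree, at every object of `R`. -/
def objectwiseQuasiIso : MorphismProperty (DGModule R) :=
  fun _ _ φ => ∀ x : R.Obj, QuasiIso (Hom.app φ x)

end DGModule

/-- A model category is cofibrantly generated (by sets, i.e. `w`-small families, of morphisms) if
there are sets `I` and `J` of morphisms which permit the small object argument and such that
the trivial fibrations are the morphisms with the right lifting property with respect to `I`,
and the fibrations those with the right lifting property with respect to `J`. -/
def IsCofibrantlyGenerated (C : Type u) [Category.{v} C] [ModelCategory C] : Prop :=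
  ∃ I J : MorphismProperty C,
    MorphismProperty.IsSmall.{w} I ∧ MorphismProperty.IsSmall.{w} J ∧
    MorphismProperty.HasSmallObjectArgument.{w} I ∧
    MorphismProperty.HasSmallObjectArgument.{w} J ∧
    trivialFibrations C = I.rlp ∧ fibrations C = J.rlp

/-- A model category is combinatorial if it is cofibrantly generated and its underlying category
is locally presentable. -/
def IsCombinatorial (C : Type u) [Category.{v} C] [ModelCategory C] : Prop :=
  IsCofibrantlyGenerated.{v, u, w} C ∧ IsLocallyPresentable.{w} C

/-! The class `monoWith R b` treats cofibrations and trivial cofibrations at once: all monomorphisms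
for `b = False`, those with acyclic cokernel for `b = True`. By the long exact sequence the latter
are the monic quasi-isomorphisms. Both classes have to be left halves of weak factorization systems
generated by sets, and the two right halves have to be compatible.

Saturation comes from cofree modules. For an injective `k`-module `E`, a map from `M` to `cosphere R
a n E` is a functional on the degree `n` part of `M` at `a` that kills boundaries, and a map to
`codisk R a E hn` is an arbitrary such functional. Lifting against these modules is extension of
functionals, so `monoWith R b` is exactly the left orthogonal of a class of tests
(`monoWith_le_llp`, `llp_le_monoWith`). No set of generators can therefore produce maps outside the
class.

A set suffices because one element generates only a bounded submodule, even when closed under a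
function that chooses primitives modulo an acyclic quotient. A map that lifts against the members of
`monoWith R b` between bounded modules lifts against all of them: by Zorn there is a maximal partial
lift, and `IsPartialLift.exists_extension` enlarges a partial lift by any given element. Free
modules represent evaluations and form a strong generator of finitely presentable objects, so the
category is locally presentable and the small object argument applies.

Finally, lifting against the inclusion of a free cycle into a free element shows that a map with the
right lifting property against monomorphisms is a quasi-isomorphism. The retract argument then
identifies these maps with the trivial fibrations (`rlp_monomorphisms`). -/

theorem LinearMap.exists_desc_of_surjective {k M N P : Type*} [Ring k] [AddCommGroup M]
    [AddCommGroup N] [AddCommGroup P] [Module k M] [Module k N] [Module k P] (f : M →ₗ[k] N)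
    (hf : Function.Surjective f) (g : M →ₗ[k] P) (h : ∀ m, f m = 0 → g m = 0) :
    ∃ l : N →ₗ[k] P, ∀ m, l (f m) = g m := by
  refine ⟨(LinearMap.ker f).liftQ g (fun m hm => h m (LinearMap.mem_ker.1 hm)) ∘ₗ
    (f.quotKerEquivOfSurjective hf).symm.toLinearMap, fun m => ?_⟩
  have : (f.quotKerEquivOfSurjective hf).symm (f m) = (LinearMap.ker f).mkQ m :=
    (LinearEquiv.symm_apply_eq _).2 rfl
  rw [LinearMap.comp_apply, LinearEquiv.coe_coe, this, Submodule.mkQ_apply]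
  exact Submodule.liftQ_apply _ _ _

/-! ### DG modules and their morphisms in terms of elements -/

namespace DGModule

variable {k : Type u} [CommRing k] {R : DGCat.{u} k}

/-- The `k`-module of the elements of degree `n` of `M` at `x`. -/
abbrev el (M : DGModule R) (x : R.Obj) (n : ℤ) : Type u := (M.cx x).X n

/-- The differential of a DG module, as a `k`-linear map. -/
abbrev dl (M : DGModule R) (x : R.Obj) (i j : ℤ) : M.el x i →ₗ[k] M.el x j := ((M.cx x).d i j).hom

/-- The linear maps underlying a morphism of DG modules. -/
def Hom.lin {M N : DGModule R} (φ : M ⟶ N) (x : R.Obj) (n : ℤ) : M.el x n →ₗ[k] N.el x n :=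
  ((Hom.app φ x).f n).hom

theorem dl_shape (M : DGModule R) (x : R.Obj) (i j : ℤ) (h : j + 1 ≠ i) : M.dl x i j = 0 := by
  have := (M.cx x).shape i j h
  simp [dl, this]

theorem dl_dl (M : DGModule R) (x : R.Obj) (i j l : ℤ) (m : M.el x i) :
    M.dl x j l (M.dl x i j m) = 0 := by
  have := (M.cx x).d_comp_d i j l
  exact congr($(this).hom m)

theorem dl_act (M : DGModule R) {x y : R.Obj} (p q n p' q' n' : ℤ) (h : p + q = n)
    (hp : p' + 1 = p) (hq : q' + 1 = q) (hn : n' + 1 = n) (f : (R.Hom x y).X p) (m : M.el x q) :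
    M.dl y n n' (M.act p q n h f m) =
      M.act p' q n' (by omega) ((R.Hom x y).d p p' f) m +
        p.negOnePow • M.act p q' n' (by omega) f (M.dl x q q' m) :=
  M.d_act p q n p' q' n' h hp hq hn f m

namespace Hom

variable {M N P : DGModule R}

@[simp] theorem lin_comp (φ : M ⟶ N) (ψ : N ⟶ P) (x : R.Obj) (n : ℤ) (m : M.el x n) :
    lin (φ ≫ ψ) x n m = lin ψ x n (lin φ x n m) := rfl

theorem lin_act (φ : M ⟶ N) {x y : R.Obj} (p q n : ℤ) (h : p + q = n) (f : (R.Hom x y).X p)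
    (m : M.el x q) : lin φ y n (M.act p q n h f m) = N.act p q n h f (lin φ x q m) :=
  Hom.app_act φ p q n h f m

theorem lin_dl (φ : M ⟶ N) (x : R.Obj) (i j : ℤ) (m : M.el x i) :
    lin φ x j (M.dl x i j m) = N.dl x i j (lin φ x i m) :=
  congr($((Hom.app φ x).comm i j).hom m).symm

theorem lin_ext {φ ψ : M ⟶ N} (h : ∀ x n m, lin φ x n m = lin ψ x n m) : φ = ψ := by
  apply Hom.ext
  funext x
  ext n m
  exact h x n m

/-- A morphism of DG modules from linear maps. -/
def ofLin (f : ∀ x n, M.el x n →ₗ[k] N.el x n)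
    (hd : ∀ x i j, j + 1 = i → ∀ m, f x j (M.dl x i j m) = N.dl x i j (f x i m))
    (ha : ∀ {x y : R.Obj} (p q n : ℤ) (h : p + q = n) (r : (R.Hom x y).X p) (m : M.el x q),
      f y n (M.act p q n h r m) = N.act p q n h r (f x q m)) : M ⟶ N :=
  show Hom M N from
  { app := fun x =>
      { f := fun n => ModuleCat.ofHom (f x n)
        comm' := fun i j hij => by
          ext m
          exact (hd x i j hij m).symm }
    app_act := ha }

@[simp] theorem lin_ofLin (f : ∀ x n, M.el x n →ₗ[k] N.el x n) (hd) (ha) (x : R.Obj) (n : ℤ)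
    (m : M.el x n) : lin (ofLin f hd ha) x n m = f x n m := rfl

theorem isIso_of_bijective (φ : M ⟶ N) (h : ∀ x n, Function.Bijective (lin φ x n)) : IsIso φ := by
  let e := fun x n => LinearEquiv.ofBijective (lin φ x n) (h x n)
  have he : ∀ x n m, lin φ x n ((e x n).symm m) = m := fun x n m => (e x n).apply_symm_apply m
  refine ⟨ofLin (fun x n => (e x n).symm) (fun x i j _ m => (h x j).1 ?_)
    (fun {x y} p q n hn r m => (h y n).1 ?_), lin_ext fun x n m => ?_, lin_ext fun x n m => ?_⟩
  · simp only [LinearEquiv.coe_coe]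
    rw [he, lin_dl, he]
  · simp only [LinearEquiv.coe_coe]
    rw [he, lin_act, he]
  · exact (e x n).symm_apply_apply m
  · exact he x n m

theorem mono_of_injective (φ : M ⟶ N) (h : ∀ x n, Function.Injective (lin φ x n)) : Mono φ where
  right_cancellation a b hab := lin_ext fun x n m => h x n (by rw [← lin_comp, hab, lin_comp])

/-- A morphism descends along an objectwise surjective morphism with smaller kernel. -/
theorem exists_desc (q : M ⟶ N) (hq : ∀ x n, Function.Surjective (lin q x n)) (φ : M ⟶ P)
    (h : ∀ x n m, lin q x n m = 0 → lin φ x n m = 0) : ∃ ψ : N ⟶ P, q ≫ ψ = φ := by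
  have hex : ∀ x n, ∃ g : N.el x n →ₗ[k] P.el x n, ∀ m, g (lin q x n m) = lin φ x n m := by
    intro x n
    exact LinearMap.exists_desc_of_surjective _ (hq x n) _ (h x n)
  choose g hg using hex
  refine ⟨ofLin g (fun x i j _ m => ?_) (fun {x y} p s n hn r m => ?_),
    lin_ext fun x n m => hg x n m⟩
  · obtain ⟨m, rfl⟩ := hq x i m
    rw [← lin_dl, hg, hg, lin_dl]
  · obtain ⟨m, rfl⟩ := hq x s m
    rw [← lin_act, hg, hg, lin_act]

end Hom

/-- Raw data for a DG module. -/
structure Data (R : DGCat.{u} k) where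
  /-- the elements -/
  E : R.Obj → ℤ → ModuleCat.{u} k
  /-- the differential -/
  d (x : R.Obj) (i j : ℤ) (h : j + 1 = i) : E x i →ₗ[k] E x j
  d_d (x : R.Obj) (i j l : ℤ) (h : j + 1 = i) (h' : l + 1 = j) (m : E x i) :
    d x j l h' (d x i j h m) = 0
  /-- the action -/
  act {x y : R.Obj} (p q n : ℤ) (h : p + q = n) :
    (R.Hom x y).X p →ₗ[k] E x q →ₗ[k] E y n
  id_act {x : R.Obj} (q : ℤ) (m : E x q) : act 0 q q (zero_add q) (R.id x) m = m
  comp_act {x y z : R.Obj} (p q r pq qr n : ℤ) (h₁ : p + q = pq) (h₂ : q + r = qr)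
      (h₃ : pq + r = n) (h₄ : p + qr = n)
      (g : (R.Hom y z).X p) (f : (R.Hom x y).X q) (m : E x r) :
    act pq r n h₃ (R.comp p q pq h₁ g f) m = act p qr n h₄ g (act q r qr h₂ f m)
  d_act {x y : R.Obj} (p q n p' q' n' : ℤ) (h : p + q = n)
      (hp : p' + 1 = p) (hq : q' + 1 = q) (hn : n' + 1 = n)
      (f : (R.Hom x y).X p) (m : E x q) :
    d y n n' hn (act p q n h f m) =
      act p' q n' (by omega) ((R.Hom x y).d p p' f) m +
        p.negOnePow • act p q' n' (by omega) f (d x q q' hq m)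

/-- The chain complexes of raw data. -/
def Data.cx (D : Data R) (x : R.Obj) : ChainComplex (ModuleCat.{u} k) ℤ where
  X n := D.E x n
  d i j := if h : j + 1 = i then ModuleCat.ofHom (D.d x i j h) else 0
  shape i j h := dif_neg h
  d_comp_d' i j l h h' := by
    have h : j + 1 = i := h
    have h' : l + 1 = j := h'
    rw [dif_pos h, dif_pos h']
    ext m
    exact D.d_d x i j l h h' m

theorem Data.cx_d (D : Data R) (x : R.Obj) (i j : ℤ) (h : j + 1 = i) (m : D.E x i) :
    (D.cx x).d i j m = D.d x i j h m := by
  have : (D.cx x).d i j = ModuleCat.ofHom (D.d x i j h) := dif_pos h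
  rw [this]
  rfl

/-- The DG module of raw data. -/
def Data.toModule (D : Data R) : DGModule R where
  cx := D.cx
  act := D.act
  id_act := D.id_act
  comp_act := D.comp_act
  d_act p q n p' q' n' h hp hq hn f m := by
    refine (D.cx_d _ _ _ hn _).trans ((D.d_act p q n p' q' n' h hp hq hn f m).trans ?_)
    exact congr(_ + p.negOnePow • D.act p q' n' _ f $((D.cx_d _ _ _ hq m).symm))

theorem Data.toModule_dl (D : Data R) (x : R.Obj) (i j : ℤ) (h : j + 1 = i) (m : D.E x i) :
    D.toModule.dl x i j m = D.d x i j h m := D.cx_d x i j h m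

end DGModule

/-! ### Twisted extensions and the construction of free DG modules -/

namespace DGModule

variable {k : Type u} [CommRing k] {R : DGCat.{u} k}

/-- A map of degree `-1` that twists the differential of the sum of two DG modules. -/
structure Twist (A B : DGModule R) where
  /-- the map -/
  δ (x : R.Obj) (i j : ℤ) (h : j + 1 = i) : A.el x i →ₗ[k] B.el x j
  δ_dl (x : R.Obj) (i j l : ℤ) (h : j + 1 = i) (h' : l + 1 = j) (a : A.el x i) :
    δ x j l h' (A.dl x i j a) + B.dl x j l (δ x i j h a) = 0
  δ_act {x y : R.Obj} (p q n q' n' : ℤ) (h : p + q = n) (hq : q' + 1 = q) (hn : n' + 1 = n)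
    (r : (R.Hom x y).X p) (a : A.el x q) : δ y n n' hn (A.act p q n h r a) =
      p.negOnePow • B.act p q' n' (by omega) r (δ x q q' hq a)

namespace Twist

variable {A B : DGModule R} (t : Twist A B)

/-- The extension of `A` by `B` that is twisted by a map `δ` of degree `-1`: the differential of
`(a, b)` is `(da, δ a + db)`. -/
def data : Data R where
  E x n := ModuleCat.of k (A.el x n × B.el x n)
  d x i j h := LinearMap.prod (A.dl x i j ∘ₗ LinearMap.fst k _ _)
    (t.δ x i j h ∘ₗ LinearMap.fst k _ _ + B.dl x i j ∘ₗ LinearMap.snd k _ _)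
  d_d x i j l h h' m := by
    refine Prod.ext (A.dl_dl x i j l _) ?_
    change t.δ x j l h' (A.dl x i j m.1) + B.dl x j l (t.δ x i j h m.1 + B.dl x i j m.2) = 0
    rw [map_add, B.dl_dl, add_zero, t.δ_dl]
  act p q n h := LinearMap.mk₂ k (fun r m => (A.act p q n h r m.1, B.act p q n h r m.2))
    (fun _ _ _ => by simp) (fun _ _ _ => by simp) (fun _ _ _ => by simp) (fun _ _ _ => by simp)
  id_act q m := Prod.ext (A.id_act q m.1) (B.id_act q m.2)
  comp_act p q r pq qr n h₁ h₂ h₃ h₄ g f m :=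
    Prod.ext (A.comp_act p q r pq qr n h₁ h₂ h₃ h₄ g f m.1)
      (B.comp_act p q r pq qr n h₁ h₂ h₃ h₄ g f m.2)
  d_act {x y} p q n p' q' n' h hp hq hn f m := by
    refine Prod.ext (A.dl_act p q n p' q' n' h hp hq hn f m.1) ?_
    change t.δ y n n' hn (A.act p q n h f m.1) + B.dl y n n' (B.act p q n h f m.2) =
      B.act p' q n' _ _ m.2 +
        p.negOnePow • B.act p q' n' _ f (t.δ x q q' hq m.1 + B.dl x q q' m.2)
    rw [B.dl_act p q n p' q' n' h hp hq hn, t.δ_act p q n q' n' h hq hn, map_add, smul_add]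
    abel

/-- The twisted extension as a DG module. -/
def toModule : DGModule R := t.data.toModule

/-- The elements of a twisted extension. -/
def equiv (x : R.Obj) (i : ℤ) : t.toModule.el x i ≃ₗ[k] A.el x i × B.el x i :=
  LinearEquiv.refl k (A.el x i × B.el x i)

theorem equiv_dl (x : R.Obj) (i j : ℤ) (h : j + 1 = i) (m : t.toModule.el x i) :
    t.equiv x j (t.toModule.dl x i j m) = (A.dl x i j (t.equiv x i m).1,
      t.δ x i j h (t.equiv x i m).1 + B.dl x i j (t.equiv x i m).2) :=
  t.data.toModule_dl x i j h m

end Twist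

/-- Degrees such as `l - (p + q)` and `l - p - q` agree only propositionally. Indexing components by
a subtype of degrees lets `subst` do the transport, with no casts in the data. -/
theorem comp_congr {x y z : R.Obj} {P : ℤ → Prop} (a : ∀ j : { j // P j }, (R.Hom x y).X j)
    {p q n q' : ℤ} (e : q = q') (h : p + q = n) (h' : p + q' = n) (hq : P q) (hq' : P q')
    (r : (R.Hom y z).X p) :
    R.comp p q n h r (a ⟨q, hq⟩) = R.comp p q' n h' r (a ⟨q', hq'⟩) := by
  subst e; rfl

/-- The elements of the free DG module on a cycle of degree `n` at `a`. The family has one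
component, in degree `m - n`. -/
abbrev SphereEl (R : DGCat.{u} k) (a : R.Obj) (n : ℤ) (y : R.Obj) (m : ℤ) : Type u :=
  ∀ j : { j : ℤ // j + n = m }, (R.Hom a y).X j

/-- The free DG module on a cycle of degree `n` at `a`. -/
def sphereData (R : DGCat.{u} k) (a : R.Obj) (n : ℤ) : Data R where
  E y m := ModuleCat.of k (SphereEl R a n y m)
  -- No sign occurs: a component `r` stands for `r u` with `u` the generating cycle, and `d (r u) =
  -- (dr) u`.
  d y i j h := LinearMap.pi fun l =>
    ((R.Hom a y).d (l + 1) l).hom ∘ₗ 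
      (LinearMap.proj (⟨l + 1, by omega⟩ : { j : ℤ // j + n = i }) : SphereEl R a n y i →ₗ[k] _)
  d_d y i j l h h' m := by
    funext s
    exact congr($((R.Hom a y).d_comp_d (s + 1 + 1) (s + 1) s).hom _)
  act p q n h := LinearMap.mk₂ k
    (fun r b l => R.comp p (l - p) l (by omega) r (b ⟨l - p, by omega⟩))
    (fun _ _ _ => by funext; simp) (fun _ _ _ => by funext; simp)
    (fun _ _ _ => by funext; simp) (fun _ _ _ => by funext; simp)
  id_act q b := by
    funext l
    refine Eq.trans ?_ (R.id_comp _ (b l))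
    exact comp_congr b (by simp) _ _ _ _ _
  comp_act p q r pq qr n h₁ h₂ h₃ h₄ g f b := by
    funext l
    refine (R.assoc p q (l - pq) pq (l - p) l h₁ (by omega) _ (by omega) g f _).trans ?_
    exact congr(R.comp p (l - p) l _ g
      $(comp_congr b (show l.1 - pq = l.1 - p - q by omega) _ _ _ _ _))
  d_act {x y} p q n p' q' n' h hp hq hn f b := by
    funext l
    refine (R.d_comp p (l + 1 - p) (l + 1) p' (l - p) l (by omega) hp (by omega) rfl f
      (b ⟨l + 1 - p, by omega⟩)).trans ?_
    refine congrArg₂ (· + ·) (comp_congr b (show l.1 + 1 - p = l.1 - p' by omega) _ _ _ _ _)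
      (congrArg (fun t => p.negOnePow • R.comp p (l - p) l (by omega) f t) ?_)
    change (R.Hom a x).d (l + 1 - p) (l - p) _ = (R.Hom a x).d (l - p + 1) (l - p) _
    have e : l + 1 - p = l - p + 1 := by omega
    generalize_proofs h₁ h₂
    revert h₁ h₂
    rw [e]
    intros; rfl

/-- The free DG module on a cycle of degree `n` at `a`. -/
def sphere (R : DGCat.{u} k) (a : R.Obj) (n : ℤ) : DGModule R := (sphereData R a n).toModule

section Sphere

variable {a : R.Obj} {n : ℤ}

/-- The component of an element of `sphere R a n`. -/
def sphereCoord {y : R.Obj} {i : ℤ} (l : ℤ) (hl : l + n = i) :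
    (sphere R a n).el y i →ₗ[k] (R.Hom a y).X l :=
  LinearMap.proj (R := k) (φ := fun j : { j : ℤ // j + n = i } => (R.Hom a y).X j) ⟨l, hl⟩

theorem sphere_ext {y : R.Obj} {i : ℤ} {b c : (sphere R a n).el y i}
    (h : ∀ l hl, sphereCoord l hl b = sphereCoord l hl c) : b = c :=
  (funext fun l => h l.1 l.2 : (b : SphereEl R a n y i) = c)

theorem sphereCoord_dl {y : R.Obj} {i j : ℤ} (h : j + 1 = i) (l l' : ℤ) (e : l + 1 = l')
    (hl : l + n = j) (b : (sphere R a n).el y i) :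
    sphereCoord l hl ((sphere R a n).dl y i j b) =
      (R.Hom a y).d l' l (sphereCoord l' (by omega) b) := by
  subst e
  exact congrFun ((sphereData R a n).toModule_dl y i j h b) ⟨l, hl⟩

theorem sphereCoord_act {x y : R.Obj} (p q i : ℤ) (h : p + q = i) (r : (R.Hom x y).X p) (l l' : ℤ)
    (e : p + l' = l) (hl : l + n = i) (b : (sphere R a n).el x q) :
    sphereCoord l hl ((sphere R a n).act p q i h r b) =
      R.comp p l' l e r (sphereCoord l' (by omega) b) :=
  comp_congr (P := fun j => j + n = q) b (show l - p = l' by omega) _ _ _ _ _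

variable (R a n) in
/-- The generator of the free DG module on a cycle. -/
def sphereUnit : (sphere R a n).el a n :=
  (fun j => (show (0 : ℤ) = j by have := j.2; omega) ▸ R.id a : SphereEl R a n a n)

theorem sphereCoord_unit : sphereCoord 0 (zero_add n) (sphereUnit R a n) = R.id a := rfl

theorem dl_sphereUnit (j : ℤ) : (sphere R a n).dl a n j (sphereUnit R a n) = 0 := by
  by_cases h : j + 1 = n
  · refine sphere_ext fun l hl => ?_
    obtain rfl : l = -1 := by omega
    rw [sphereCoord_dl h (-1) 0 rfl, sphereCoord_unit, R.d_id, map_zero]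
  · rw [dl_shape _ _ _ _ h, LinearMap.zero_apply]

/-- Every element is a multiple of the generator, which is why a morphism out of `sphere R a n` is
determined by one value. -/
theorem act_sphereUnit (y : R.Obj) (l i : ℤ) (hl : l + n = i) (b : (sphere R a n).el y i) :
    (sphere R a n).act l n i hl (sphereCoord l hl b) (sphereUnit R a n) = b := by
  refine sphere_ext fun l' hl' => ?_
  obtain rfl : l = l' := by omega
  rw [sphereCoord_act l n i hl _ l 0 (add_zero l) hl', sphereCoord_unit, R.comp_id]

variable {n' : ℤ} (hn : n + 1 = n')

variable (R a) in
/-- The shift of the generator. -/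
def sphereShift (y : R.Obj) (i j : ℤ) (hij : j + 1 = i) :
    (sphere R a n').el y i →ₗ[k] (sphere R a n).el y j :=
  show SphereEl R a n' y i →ₗ[k] SphereEl R a n y j from
  -- The sign of the second term in `d (r u) = (dr) u + (-1) ^ |r| r du`; the target copy of
  -- `sphere` consists of the multiples of `du`.
  LinearMap.pi fun l => l.1.negOnePow •
    (LinearMap.proj (⟨l, by omega⟩ : { l : ℤ // l + n' = i }) : SphereEl R a n' y i →ₗ[k] _)

theorem sphereCoord_shift (y : R.Obj) (i j : ℤ) (hij : j + 1 = i) (l : ℤ) (hl : l + n = j)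
    (b : (sphere R a n').el y i) : sphereCoord l hl (sphereShift R a hn y i j hij b) =
      (l.negOnePow : ℤ) • sphereCoord l (by omega) b := rfl

variable (R a) in
/-- The twist of the free DG module on an element. -/
def sphereTwist : Twist (sphere R a n') (sphere R a n) where
  δ := sphereShift R a hn
  δ_dl y i j l hij hjl b := by
    refine sphere_ext fun s hs => ?_
    rw [map_add, sphereCoord_shift, sphereCoord_dl hij s _ rfl, sphereCoord_dl hjl s _ rfl,
      sphereCoord_shift, Int.negOnePow_succ, map_zsmul, Units.val_neg, neg_smul, add_neg_cancel,
      map_zero]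
  δ_act {x y} p q m q' m' hpq hq hm r b := by
    refine sphere_ext fun s hs => ?_
    obtain ⟨t, rfl⟩ : ∃ t, p + t = s := ⟨s - p, by omega⟩
    rw [sphereCoord_shift, sphereCoord_act p q m hpq r _ t rfl, Units.smul_def, map_zsmul,
      sphereCoord_act p q' m' _ r _ t rfl, sphereCoord_shift, map_zsmul,
      smul_smul, ← Units.val_mul, ← Int.negOnePow_add]

variable (R a) in
/-- The free DG module on an element of degree `n'` at `a`. -/
def free : DGModule R := (sphereTwist R a hn).toModule

variable (R a) in
/-- The elements of the free DG module on an element. -/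
def freeEquiv (y : R.Obj) (i : ℤ) :
    (free R a hn).el y i ≃ₗ[k] (sphere R a n').el y i × (sphere R a n).el y i :=
  (sphereTwist R a hn).equiv y i

theorem freeEquiv_dl (y : R.Obj) (i j : ℤ) (h : j + 1 = i) (m : (free R a hn).el y i) :
    freeEquiv R a hn y j ((free R a hn).dl y i j m) =
      ((sphere R a n').dl y i j (freeEquiv R a hn y i m).1,
        sphereShift R a hn y i j h (freeEquiv R a hn y i m).1 +
        (sphere R a n).dl y i j (freeEquiv R a hn y i m).2) := (sphereTwist R a hn).equiv_dl y i j h m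

theorem freeEquiv_act {x y : R.Obj} (p q i : ℤ) (h : p + q = i) (r : (R.Hom x y).X p)
    (m : (free R a hn).el x q) :
    freeEquiv R a hn y i ((free R a hn).act p q i h r m) =
      ((sphere R a n').act p q i h r (freeEquiv R a hn x q m).1,
        (sphere R a n).act p q i h r (freeEquiv R a hn x q m).2) := rfl

variable (R a) in
/-- The generator of the free DG module on an element. -/
def freeUnit : (free R a hn).el a n' := (freeEquiv R a hn a n').symm (sphereUnit R a n', 0)

theorem freeEquiv_unit : freeEquiv R a hn a n' (freeUnit R a hn) = (sphereUnit R a n', 0) :=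
  LinearEquiv.apply_symm_apply _ _

/-- The purpose of the twist: the second summand is generated by the differential of the generator
of the first. The sign is trivial because the identity has degree `0`. -/
theorem freeEquiv_dl_unit :
    freeEquiv R a hn a n ((free R a hn).dl a n' n (freeUnit R a hn)) = (0, sphereUnit R a n) := by
  rw [freeEquiv_dl hn a n' n hn, freeEquiv_unit]
  refine Prod.ext (dl_sphereUnit n) ?_
  rw [map_zero, add_zero]
  refine sphere_ext fun l hl => ?_
  obtain rfl : l = 0 := by omega
  rw [sphereCoord_shift, sphereCoord_unit, sphereCoord_unit, Int.negOnePow_zero, Units.val_one,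
    one_smul]

end Sphere

end DGModule

/-! ### Universal properties of free DG modules; monomorphisms are injective -/

namespace DGModule

variable {k : Type u} [CommRing k] {R : DGCat.{u} k}

section

variable (M : DGModule R) {a : R.Obj} {n : ℤ}

/-- The action on an element of degree `n`. -/
def sphereAct (m : M.el a n) (y : R.Obj) (i : ℤ) : (sphere R a n).el y i →ₗ[k] M.el y i :=
  (M.act (i - n) n i (by omega)).flip m ∘ₗ sphereCoord (i - n) (by omega)

theorem sphereAct_apply (m : M.el a n) (y : R.Obj) (i : ℤ) (b : (sphere R a n).el y i)
    (l : ℤ) (hl : l + n = i) : M.sphereAct m y i b = M.act l n i hl (sphereCoord l hl b) m := by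
  obtain rfl : l = i - n := by omega
  rfl

theorem sphereAct_act (m : M.el a n) {x y : R.Obj} (p q i : ℤ) (h : p + q = i)
    (r : (R.Hom x y).X p) (b : (sphere R a n).el x q) :
    M.sphereAct m y i ((sphere R a n).act p q i h r b) = M.act p q i h r (M.sphereAct m x q b) := by
  rw [M.sphereAct_apply m y i _ (i - n) (by omega), M.sphereAct_apply m x q _ (q - n) (by omega),
    sphereCoord_act p q i h r (i - n) (q - n) (by omega),
    M.comp_act p (q - n) n (i - n) q i (by omega) (by omega) (by omega) (by omega)]

/-- The Leibniz rule for `r ↦ r m`. The correction term vanishes when `m` is a cycle, and in `free`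
it is matched by the twist. -/
theorem sphereAct_dl {n' : ℤ} (hn : n + 1 = n') (m : M.el a n') (y : R.Obj) (i j : ℤ)
    (h : j + 1 = i) (b : (sphere R a n').el y i) :
    M.dl y i j (M.sphereAct m y i b) = M.sphereAct m y j ((sphere R a n').dl y i j b) +
      M.sphereAct (M.dl a n' n m) y j (sphereShift R a hn y i j h b) := by
  rw [M.sphereAct_apply m y i b (i - n') (by omega), M.sphereAct_apply m y j _ (j - n') (by omega),
    M.sphereAct_apply _ y j _ (i - n') (by omega), sphereCoord_shift,
    sphereCoord_dl h (j - n') (i - n') (by omega),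
    M.dl_act (i - n') n' i (j - n') n j (by omega) (by omega) hn h, map_zsmul,
    LinearMap.smul_apply, Units.smul_def]

theorem sphereAct_zero (y : R.Obj) (i : ℤ) : M.sphereAct (0 : M.el a n) y i = 0 := by
  simp [sphereAct]

theorem sphereAct_unit (m : M.el a n) : M.sphereAct m a n (sphereUnit R a n) = m := by
  rw [M.sphereAct_apply m a n _ 0 (zero_add n), sphereCoord_unit, M.id_act]

/-- The morphism from the free DG module on a cycle given by a cycle. -/
def sphereDesc (m : M.el a n) (hm : ∀ j, M.dl a n j m = 0) : sphere R a n ⟶ M :=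
  Hom.ofLin (M.sphereAct m)
    (fun y i j h b => by
      rw [sphereAct_dl M (sub_add_cancel n 1) m y i j h b, hm, sphereAct_zero,
        LinearMap.zero_apply, add_zero])
    (fun p q i h r b => M.sphereAct_act m p q i h r b)

theorem sphereDesc_unit (m : M.el a n) (hm : ∀ j, M.dl a n j m = 0) :
    Hom.lin (M.sphereDesc m hm) a n (sphereUnit R a n) = m := M.sphereAct_unit m

variable {M} in
theorem sphere_hom_ext {φ ψ : sphere R a n ⟶ M}
    (h : Hom.lin φ a n (sphereUnit R a n) = Hom.lin ψ a n (sphereUnit R a n)) : φ = ψ := by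
  refine Hom.lin_ext fun y i b => ?_
  rw [← act_sphereUnit y (i - n) i (by omega) b, Hom.lin_act, Hom.lin_act, h]

variable {n' : ℤ} (hn : n + 1 = n')

/-- The morphism from the free DG module on an element given by an element. -/
def freeDesc (m : M.el a n') : free R a hn ⟶ M :=
  Hom.ofLin (fun y i => (M.sphereAct m y i).coprod (M.sphereAct (M.dl a n' n m) y i) ∘ₗ
      (freeEquiv R a hn y i).toLinearMap)
    (fun y i j h b => by
      simp only [LinearMap.comp_apply, LinearEquiv.coe_coe, LinearMap.coprod_apply]
      rw [freeEquiv_dl hn y i j h, map_add, map_add, sphereAct_dl M hn m y i j h,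
        sphereAct_dl M (sub_add_cancel n 1) _ y i j h, M.dl_dl, sphereAct_zero,
        LinearMap.zero_apply, add_zero, add_assoc])
    (fun {x y} p q i h r b => by
      simp only [LinearMap.comp_apply, LinearEquiv.coe_coe, LinearMap.coprod_apply]
      rw [freeEquiv_act, map_add, sphereAct_act, sphereAct_act])

theorem freeDesc_unit (m : M.el a n') :
    Hom.lin (M.freeDesc hn m) a n' (freeUnit R a hn) = m := by
  simp only [freeDesc, Hom.lin_ofLin, LinearMap.comp_apply, LinearEquiv.coe_coe, freeEquiv_unit,
    LinearMap.coprod_apply, map_zero, add_zero, sphereAct_unit]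

variable {M} in
theorem free_hom_ext {φ ψ : free R a hn ⟶ M}
    (h : Hom.lin φ a n' (freeUnit R a hn) = Hom.lin ψ a n' (freeUnit R a hn)) : φ = ψ := by
  refine Hom.lin_ext fun y i b => ?_
  -- With `u` the generator, every element has the form `r u + s du`.
  have e : b = (free R a hn).act (i - n') n' i (by omega)
      (sphereCoord (i - n') (by omega) (freeEquiv R a hn y i b).1) (freeUnit R a hn) +
      (free R a hn).act (i - n) n i (by omega)
      (sphereCoord (i - n) (by omega) (freeEquiv R a hn y i b).2)
      ((free R a hn).dl a n' n (freeUnit R a hn)) := by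
    apply (freeEquiv R a hn y i).injective
    rw [map_add, freeEquiv_act, freeEquiv_act, freeEquiv_dl_unit, freeEquiv_unit, act_sphereUnit,
      act_sphereUnit, map_zero, map_zero, Prod.mk_add_mk, add_zero, zero_add]
  rw [e, map_add, map_add, Hom.lin_act, Hom.lin_act, Hom.lin_act, Hom.lin_act, Hom.lin_dl,
    Hom.lin_dl, h]

variable (R a) in
/-- The free DG module on a cycle in the free DG module on an element. -/
def sphereToFree : sphere R a n ⟶ free R a hn :=
  Hom.ofLin (fun y i => (freeEquiv R a hn y i).symm.toLinearMap ∘ₗ LinearMap.inr k _ _)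
    (fun y i j h b => by
      apply (freeEquiv R a hn y j).injective
      simp [freeEquiv_dl hn y i j h])
    (fun {x y} p q i h r b => by
      apply (freeEquiv R a hn y i).injective
      simp [freeEquiv_act])

theorem sphereToFree_injective (y : R.Obj) (i : ℤ) :
    Function.Injective (Hom.lin (sphereToFree R a hn) y i) :=
  (freeEquiv R a hn y i).symm.injective.comp LinearMap.inr_injective

theorem sphereToFree_unit : Hom.lin (sphereToFree R a hn) a n (sphereUnit R a n) =
    (free R a hn).dl a n' n (freeUnit R a hn) := by
  apply (freeEquiv R a hn a n).injective
  rw [freeEquiv_dl_unit]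
  exact LinearEquiv.apply_symm_apply _ _

end

/-- Elements of `M` are morphisms from a free DG module, so left cancellation is injectivity on
elements. -/
theorem Hom.injective_of_mono {M N : DGModule R} (φ : M ⟶ N) [Mono φ] (x : R.Obj) (n : ℤ) :
    Function.Injective (Hom.lin φ x n) := by
  intro m m' h
  have hn := sub_add_cancel n 1
  have : M.freeDesc hn m ≫ φ = M.freeDesc hn m' ≫ φ :=
    free_hom_ext _ (by rw [lin_comp, lin_comp, freeDesc_unit, freeDesc_unit, h])
  rw [cancel_mono] at this
  rw [← freeDesc_unit M hn m, this, freeDesc_unit]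

theorem Hom.mono_iff_injective {M N : DGModule R} (φ : M ⟶ N) :
    Mono φ ↔ ∀ x n, Function.Injective (Hom.lin φ x n) :=
  ⟨fun _ => injective_of_mono φ, mono_of_injective φ⟩

end DGModule

/-! ### Cofree DG modules and their universal properties -/

namespace DGModule

variable {k : Type u} [CommRing k] {R : DGCat.{u} k}

/-- The elements of the cofree DG module on a `k`-module in degree `n` at `a`. The family has one
component, in degree `n - m`. -/
abbrev CosphereEl (R : DGCat.{u} k) (a : R.Obj) (n : ℤ) (E : ModuleCat.{u} k) (y : R.Obj) (m : ℤ) :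
    Type u :=
  ∀ j : { j : ℤ // j + m = n }, (R.Hom y a).X j →ₗ[k] E

theorem apply_comp_congr {x y z : R.Obj} {P : ℤ → Prop} {E : ModuleCat.{u} k}
    (ψ : ∀ j : { j // P j }, (R.Hom x z).X j →ₗ[k] E) {p q t t' : ℤ} (e : t = t') (h : p + q = t)
    (h' : p + q = t') (ht : P t) (ht' : P t') (g : (R.Hom y z).X p) (f : (R.Hom x y).X q) :
    ψ ⟨t, ht⟩ (R.comp p q t h g f) = ψ ⟨t', ht'⟩ (R.comp p q t' h' g f) := by
  subst e; rfl

/-- The cofree DG module on a `k`-module `E` in degree `n` at `a`. -/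
def cosphereData (R : DGCat.{u} k) (a : R.Obj) (n : ℤ) (E : ModuleCat.{u} k) : Data R where
  E y m := ModuleCat.of k (CosphereEl R a n E y m)
  d y i j h :=
    -- The component of `m` at `f` is to be `φ (f m)` for a functional `φ` that kills boundaries.
    -- Applying `φ` to `d (f m)` forces `φ (f dm) = -(-1) ^ |f| φ ((df) m)`, hence the exponent `l +
    -- 1`.
    { toFun := fun (ψ : CosphereEl R a n E y i) l => (l.1 + 1).negOnePow •
        (ψ ⟨l - 1, by omega⟩ ∘ₗ ((R.Hom y a).d l (l - 1)).hom)
      map_add' := fun ψ χ => by funext l; simp [LinearMap.add_comp]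
      map_smul' := fun c ψ => by funext l; simp [LinearMap.smul_comp, smul_comm c] }
  d_d y i j l h h' ψ := by
    funext s
    refine LinearMap.ext fun f => ?_
    change (s.1 + 1).negOnePow • (s.1 - 1 + 1).negOnePow • ψ ⟨s - 1 - 1, _⟩
      ((R.Hom y a).d (s - 1) (s - 1 - 1) ((R.Hom y a).d s (s - 1) f)) = 0
    have : (R.Hom y a).d (s - 1) (s - 1 - 1) ((R.Hom y a).d s (s - 1) f) = 0 :=
      congr($((R.Hom y a).d_comp_d s (s - 1) (s - 1 - 1)).hom f)
    rw [this, map_zero, smul_zero, smul_zero]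
  act {x y} p q m h := LinearMap.mk₂ k
    (fun r (ψ : CosphereEl R a n E x q) l =>
      ψ ⟨l + p, by omega⟩ ∘ₗ (R.comp (z := a) l p (l + p) rfl).flip r)
    (fun _ _ _ => by funext; ext; simp) (fun _ _ _ => by funext; ext; simp)
    (fun _ _ _ => by funext; ext; simp) (fun _ _ _ => by funext; ext; simp)
  id_act {x} q ψ := by
    funext l
    refine LinearMap.ext fun s => ?_
    refine (apply_comp_congr (P := fun j => j + q = n) ψ (add_zero l.1) _ (add_zero l.1) _ l.2 s
      (R.id x)).trans ?_
    exact congrArg (ψ l) (R.comp_id l.1 s)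
  comp_act {x y z} p q r pq qr m h₁ h₂ h₃ h₄ g f ψ := by
    funext l
    refine LinearMap.ext fun s => ?_
    refine (apply_comp_congr (P := fun j => j + r = n) ψ
      (show l.1 + pq = l.1 + p + q by omega) _ (by omega) _ (by omega) s _).trans ?_
    exact congrArg (ψ ⟨l + p + q, by omega⟩) (R.assoc l p q (l + p) pq (l + p + q) rfl h₁ rfl
      (by omega) s g f).symm
  d_act {x y} p q m p' q' m' h hp hq hm f ψ := by
    funext l
    refine LinearMap.ext fun s => ?_
    obtain ⟨l, hl⟩ := l
    change (l + 1).negOnePow • ψ ⟨l - 1 + p, _⟩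
        (R.comp (l - 1) p (l - 1 + p) _ ((R.Hom y a).d l (l - 1) s) f) =
      ψ ⟨l + p', _⟩ (R.comp l p' (l + p') _ s ((R.Hom x y).d p p' f)) +
        p.negOnePow • (l + p + 1).negOnePow •
          ψ ⟨l + p - 1, _⟩ ((R.Hom x a).d (l + p) (l + p - 1) (R.comp l p (l + p) _ s f))
    rw [R.d_comp l p (l + p) (l - 1) p' (l + p - 1) rfl (by omega) hp (by omega) s f, map_add,
      Units.smul_def l.negOnePow, map_zsmul,
      apply_comp_congr (P := fun j => j + q = n) ψ (show l - 1 + p = l + p - 1 by omega) _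
        (by omega) _ (by omega),
      apply_comp_congr (P := fun j => j + q = n) ψ (show l + p' = l + p - 1 by omega) _
        (by omega) _ (by omega)]
    rw [Int.negOnePow_add, Int.negOnePow_add, Int.negOnePow_add, Int.negOnePow_one]
    rcases Int.units_eq_one_or l.negOnePow with e | e <;>
    rcases Int.units_eq_one_or p.negOnePow with e' | e' <;> simp [e, e']

section Cosphere

variable (R) (a : R.Obj) (n : ℤ) (E : ModuleCat.{u} k)

/-- The cofree DG module on a `k`-module `E` in degree `n` at `a`. -/
def cosphere : DGModule R := (cosphereData R a n E).toModule

variable {R a n E}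

/-- The component of an element of `cosphere R a n E`. -/
def cosphereCoord {y : R.Obj} {i : ℤ} (l : ℤ) (hl : l + i = n) :
    (cosphere R a n E).el y i →ₗ[k] (R.Hom y a).X l →ₗ[k] E :=
  LinearMap.proj (R := k) (φ := fun j : { j : ℤ // j + i = n } => (R.Hom y a).X j →ₗ[k] E) ⟨l, hl⟩

/-- An element of `cosphere R a n E`. -/
def cosphereMk {y : R.Obj} {i : ℤ} (l : ℤ) (hl : l + i = n) :
    ((R.Hom y a).X l →ₗ[k] E) →ₗ[k] (cosphere R a n E).el y i :=
  LinearMap.pi (R := k) (φ := fun j : { j : ℤ // j + i = n } => (R.Hom y a).X j →ₗ[k] E)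
    fun j => (show l = j by omega) ▸ LinearMap.id

theorem cosphere_ext {y : R.Obj} {i : ℤ} {b c : (cosphere R a n E).el y i}
    (h : ∀ l hl f, cosphereCoord l hl b f = cosphereCoord l hl c f) : b = c :=
  (funext fun l => LinearMap.ext (h l.1 l.2) : (b : CosphereEl R a n E y i) = c)

theorem cosphereCoord_dl {y : R.Obj} {i j : ℤ} (h : j + 1 = i) (l l' : ℤ) (e : l' + 1 = l)
    (hl : l + j = n) (b : (cosphere R a n E).el y i) (f : (R.Hom y a).X l) :
    cosphereCoord l hl ((cosphere R a n E).dl y i j b) f =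
      ((l + 1).negOnePow : ℤ) • cosphereCoord l' (by omega) b ((R.Hom y a).d l l' f) := by
  obtain rfl : l' = l - 1 := by omega
  exact congr($(congrFun ((cosphereData R a n E).toModule_dl y i j h b) ⟨l, hl⟩) f)

theorem cosphereCoord_act {x y : R.Obj} (p q i : ℤ) (h : p + q = i) (r : (R.Hom x y).X p)
    (l l' : ℤ) (e : l + p = l') (hl : l + i = n) (b : (cosphere R a n E).el x q)
    (f : (R.Hom y a).X l) :
    cosphereCoord l hl ((cosphere R a n E).act p q i h r b) f =
      cosphereCoord l' (by omega) b (R.comp l p l' e f r) := by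
  subst e; rfl

variable {n' : ℤ} (hn : n + 1 = n')

variable (R a E) in
/-- The shift of cofree DG modules. -/
def cosphereShift (y : R.Obj) (i j : ℤ) (hij : j + 1 = i) :
    (cosphere R a n' E).el y i →ₗ[k] (cosphere R a n E).el y j :=
  show CosphereEl R a n' E y i →ₗ[k] CosphereEl R a n E y j from
  -- If `φ` does not kill boundaries, `φ (f dm)` has the further term `(-1) ^ |f| φ (d (f m))`,
  -- which this map supplies.
  LinearMap.pi fun l => l.1.negOnePow • LinearMap.proj (R := k)
    (φ := fun j : { j : ℤ // j + i = n' } => (R.Hom y a).X j →ₗ[k] E) ⟨l.1, by omega⟩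

theorem cosphereCoord_shift (y : R.Obj) (i j : ℤ) (hij : j + 1 = i) (l : ℤ) (hl : l + j = n)
    (b : (cosphere R a n' E).el y i) (f : (R.Hom y a).X l) :
    cosphereCoord l hl (cosphereShift R a E hn y i j hij b) f =
      (l.negOnePow : ℤ) • cosphereCoord l (by omega) b f := rfl

variable (R a E) in
/-- The twist of the cofree DG module on the cone of a `k`-module. -/
def cosphereTwist : Twist (cosphere R a n' E) (cosphere R a n E) where
  δ := cosphereShift R a E hn
  δ_dl y i j l hij hjl b := by
    refine cosphere_ext fun s hs f => ?_
    obtain ⟨t, rfl⟩ : ∃ t, t + 1 = s := ⟨s - 1, by omega⟩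
    rw [map_add, LinearMap.add_apply, cosphereCoord_shift, cosphereCoord_dl hij _ t rfl,
      cosphereCoord_dl hjl _ t rfl, cosphereCoord_shift, map_zero, LinearMap.zero_apply,
      smul_smul, smul_smul, ← add_smul, Int.negOnePow_succ, Int.negOnePow_succ]
    refine (congrArg (· • _) ?_).trans (zero_smul ℤ _)
    rw [Units.val_neg]
    ring
  δ_act {x y} p q m q' m' hpq hq hm r b := by
    refine cosphere_ext fun s hs f => ?_
    rw [cosphereCoord_shift, cosphereCoord_act p q m hpq r s _ rfl, Units.smul_def, map_zsmul,
      LinearMap.smul_apply, cosphereCoord_act p q' m' _ r s _ rfl, cosphereCoord_shift,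
      smul_smul, ← Units.val_mul, ← Int.negOnePow_add]
    congr 2
    rw [Int.negOnePow_add, Int.negOnePow_add, mul_left_comm, ← Int.negOnePow_add p p,
      Int.negOnePow_even _ ⟨p, rfl⟩, mul_one]

variable (R a E) in
/-- The cofree DG module on a contractible complex. -/
def codisk : DGModule R := (cosphereTwist R a E hn).toModule

variable (R a E) in
/-- The elements of the cofree DG module on a contractible complex. -/
def codiskEquiv (y : R.Obj) (i : ℤ) :
    (codisk R a E hn).el y i ≃ₗ[k] (cosphere R a n' E).el y i × (cosphere R a n E).el y i :=
  (cosphereTwist R a E hn).equiv y i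

theorem codiskEquiv_dl (y : R.Obj) (i j : ℤ) (h : j + 1 = i) (m : (codisk R a E hn).el y i) :
    codiskEquiv R a E hn y j ((codisk R a E hn).dl y i j m) =
      ((cosphere R a n' E).dl y i j (codiskEquiv R a E hn y i m).1,
        cosphereShift R a E hn y i j h (codiskEquiv R a E hn y i m).1 +
        (cosphere R a n E).dl y i j (codiskEquiv R a E hn y i m).2) :=
  (cosphereTwist R a E hn).equiv_dl y i j h m

theorem codiskEquiv_act {x y : R.Obj} (p q i : ℤ) (h : p + q = i) (r : (R.Hom x y).X p)
    (m : (codisk R a E hn).el x q) :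
    codiskEquiv R a E hn y i ((codisk R a E hn).act p q i h r m) =
      ((cosphere R a n' E).act p q i h r (codiskEquiv R a E hn x q m).1,
        (cosphere R a n E).act p q i h r (codiskEquiv R a E hn x q m).2) := rfl

variable (R a E) in
/-- The projection of the contractible cofree DG module. -/
def codiskToCosphere : codisk R a E hn ⟶ cosphere R a n' E :=
  Hom.ofLin (fun y i => LinearMap.fst k _ _ ∘ₗ (codiskEquiv R a E hn y i).toLinearMap)
    (fun y i j h b => by simp [codiskEquiv_dl hn y i j h])
    (fun {x y} p q i h r b => by simp [codiskEquiv_act])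

/-- The functional on a DG module given by a morphism to a cofree one. -/
def cosphereEval {M : DGModule R} (φ : M ⟶ cosphere R a n E) : M.el a n →ₗ[k] E :=
  (LinearMap.applyₗ (R.id a)) ∘ₗ cosphereCoord 0 (zero_add n) ∘ₗ Hom.lin φ a n

/-- The identity is a cycle, so the functional of a morphism to `cosphere` kills boundaries;
`cosphereLift` is the converse. -/
theorem cosphereEval_dl {M : DGModule R} (φ : M ⟶ cosphere R a n E) (j : ℤ) (m : M.el a j) :
    cosphereEval φ (M.dl a j n m) = 0 := by
  by_cases h : n + 1 = j
  · change cosphereCoord 0 (zero_add n) (Hom.lin φ a n (M.dl a j n m)) (R.id a) = 0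
    rw [Hom.lin_dl, cosphereCoord_dl h 0 (-1) rfl, R.d_id, map_zero, smul_zero]
  · rw [dl_shape _ _ _ _ h, LinearMap.zero_apply, map_zero]

/-- The Yoneda argument: compatibility with the action recovers all components from evaluation at
the identity. -/
theorem cosphereCoord_lin {M : DGModule R} (φ : M ⟶ cosphere R a n E) {y : R.Obj} {i : ℤ} (l : ℤ)
    (hl : l + i = n) (m : M.el y i) (f : (R.Hom y a).X l) :
    cosphereCoord l hl (Hom.lin φ y i m) f = cosphereEval φ (M.act l i n hl f m) := by
  change _ = cosphereCoord 0 (zero_add n) (Hom.lin φ a n (M.act l i n hl f m)) (R.id a)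
  rw [Hom.lin_act, cosphereCoord_act l i n hl f 0 l (zero_add l), R.id_comp]

theorem cosphere_hom_ext {M : DGModule R} {φ ψ : M ⟶ cosphere R a n E}
    (h : ∀ m, cosphereEval φ m = cosphereEval ψ m) : φ = ψ :=
  Hom.lin_ext fun y i m => cosphere_ext fun l hl f => by
    rw [cosphereCoord_lin, cosphereCoord_lin, h]

/-- The functional on a DG module given by a morphism to a contractible cofree one. -/
def codiskEval {M : DGModule R} (φ : M ⟶ codisk R a E hn) : M.el a n →ₗ[k] E :=
  LinearMap.applyₗ (R.id a) ∘ₗ cosphereCoord 0 (zero_add n) ∘ₗ LinearMap.snd k _ _ ∘ₗ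
    (codiskEquiv R a E hn a n).toLinearMap ∘ₗ Hom.lin φ a n

/-- On functionals, the projection from `codisk` to `cosphere` is precomposition with the
differential. This turns lifting problems against it into extension problems. -/
theorem cosphereEval_codisk {M : DGModule R} (φ : M ⟶ codisk R a E hn) (m : M.el a n') :
    cosphereEval (φ ≫ codiskToCosphere R a E hn) m = codiskEval hn φ (M.dl a n' n m) := by
  change cosphereCoord 0 (zero_add n') (codiskEquiv R a E hn a n' (Hom.lin φ a n' m)).1 (R.id a) =
    cosphereCoord 0 (zero_add n)
      (codiskEquiv R a E hn a n (Hom.lin φ a n (M.dl a n' n m))).2 (R.id a)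
  rw [Hom.lin_dl, codiskEquiv_dl hn a n' n hn, map_add, LinearMap.add_apply,
    cosphereCoord_dl hn 0 (-1) rfl, R.d_id, map_zero, smul_zero, add_zero, cosphereCoord_shift,
    Int.negOnePow_zero, Units.val_one, one_smul]

theorem codisk_hom_ext {M : DGModule R} {φ ψ : M ⟶ codisk R a E hn}
    (h : ∀ m, codiskEval hn φ m = codiskEval hn ψ m) : φ = ψ := by
  refine Hom.lin_ext fun y i m => (codiskEquiv R a E hn y i).injective (Prod.ext ?_ ?_)
  · have : φ ≫ codiskToCosphere R a E hn = ψ ≫ codiskToCosphere R a E hn :=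
      cosphere_hom_ext fun m => by rw [cosphereEval_codisk, cosphereEval_codisk, h]
    exact congr(Hom.lin $this y i m)
  · refine cosphere_ext fun l hl f => ?_
    have key (χ : M ⟶ codisk R a E hn) :
        cosphereCoord l hl (codiskEquiv R a E hn y i (Hom.lin χ y i m)).2 f =
          codiskEval hn χ (M.act l i n hl f m) := by
      change _ = cosphereCoord 0 (zero_add n)
        (codiskEquiv R a E hn a n (Hom.lin χ a n (M.act l i n hl f m))).2 (R.id a)
      rw [Hom.lin_act, codiskEquiv_act, cosphereCoord_act l i n hl f 0 l (zero_add l), R.id_comp]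
    rw [key, key, h]

/-- The linear map to a cofree DG module given by a functional. -/
def cosphereCoact (M : DGModule R) (φ : M.el a n →ₗ[k] E) (y : R.Obj) (i : ℤ) :
    M.el y i →ₗ[k] (cosphere R a n E).el y i :=
  cosphereMk (n - i) (sub_add_cancel n i) ∘ₗ
    (LinearMap.compr₂ (M.act (y := a) (n - i) i n (sub_add_cancel n i)) φ).flip

theorem cosphereCoord_coact (M : DGModule R) (φ : M.el a n →ₗ[k] E) (y : R.Obj) (i : ℤ)
    (m : M.el y i) (l : ℤ) (hl : l + i = n) (f : (R.Hom y a).X l) :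
    cosphereCoord l hl (cosphereCoact M φ y i m) f = φ (M.act l i n hl f m) := by
  obtain rfl : l = n - i := by omega
  rfl

theorem cosphereCoact_act (M : DGModule R) (φ : M.el a n →ₗ[k] E) {x y : R.Obj} (p q i : ℤ)
    (h : p + q = i) (r : (R.Hom x y).X p) (m : M.el x q) :
    cosphereCoact M φ y i (M.act p q i h r m) =
      (cosphere R a n E).act p q i h r (cosphereCoact M φ x q m) := by
  refine cosphere_ext fun l hl f => ?_
  rw [cosphereCoord_act p q i h r l _ rfl, cosphereCoord_coact, cosphereCoord_coact,
    M.comp_act l p q (l + p) i n rfl h]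

theorem cosphereCoact_dl (M : DGModule R) (φ : M.el a n →ₗ[k] E) (y : R.Obj) (i j : ℤ)
    (h : j + 1 = i) (m : M.el y i) :
    cosphereCoact M φ y j (M.dl y i j m) =
      cosphereShift R a E hn y i j h (cosphereCoact M (φ ∘ₗ M.dl a n' n) y i m) +
        (cosphere R a n E).dl y i j (cosphereCoact M φ y i m) := by
  refine cosphere_ext fun l hl f => ?_
  obtain ⟨t, rfl⟩ : ∃ t, t + 1 = l := ⟨l - 1, by omega⟩
  rw [map_add, LinearMap.add_apply, cosphereCoord_shift, cosphereCoord_dl h _ t rfl,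
    cosphereCoord_coact, cosphereCoord_coact, cosphereCoord_coact, LinearMap.comp_apply,
    M.dl_act (t + 1) i n' t j n (by omega) rfl h hn, map_add, Units.smul_def, map_zsmul, smul_add,
    smul_smul, ← Units.val_mul, ← Int.negOnePow_add, Int.negOnePow_even _ ⟨t + 1, rfl⟩,
    Units.val_one, one_smul, Int.negOnePow_succ (t + 1), Units.val_neg, neg_smul]
  abel

/-- The morphism to a cofree DG module given by a functional that vanishes on boundaries. -/
def cosphereLift (M : DGModule R) (φ : M.el a n →ₗ[k] E) (hφ : ∀ j m, φ (M.dl a j n m) = 0) :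
    M ⟶ cosphere R a n E :=
  Hom.ofLin (cosphereCoact M φ)
    (fun y i j h m => by
      have : φ ∘ₗ M.dl a (n + 1) n = 0 := LinearMap.ext (hφ (n + 1))
      rw [cosphereCoact_dl rfl M φ y i j h m, this, add_eq_right]
      refine cosphere_ext fun l hl f => ?_
      rw [cosphereCoord_shift, cosphereCoord_coact, LinearMap.zero_apply, smul_zero, map_zero,
        LinearMap.zero_apply])
    (fun p q i h r m => cosphereCoact_act M φ p q i h r m)

theorem cosphereEval_lift (M : DGModule R) (φ : M.el a n →ₗ[k] E) (hφ) (m : M.el a n) :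
    cosphereEval (cosphereLift M φ hφ) m = φ m :=
  (cosphereCoord_coact M φ a n m 0 (zero_add n) (R.id a)).trans (by rw [M.id_act])

/-- The morphism to a contractible cofree DG module given by a functional. -/
def codiskLift (M : DGModule R) (φ : M.el a n →ₗ[k] E) : M ⟶ codisk R a E hn :=
  Hom.ofLin (fun y i => (codiskEquiv R a E hn y i).symm.toLinearMap ∘ₗ
      (cosphereCoact M (φ ∘ₗ M.dl a n' n) y i).prod (cosphereCoact M φ y i))
    (fun y i j h m => by
      apply (codiskEquiv R a E hn y j).injective
      rw [codiskEquiv_dl hn y i j h]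
      simp only [LinearMap.comp_apply, LinearEquiv.coe_coe, LinearEquiv.apply_symm_apply,
        LinearMap.prod_apply, Function.prod]
      refine Prod.ext ?_ (cosphereCoact_dl hn M φ y i j h m)
      exact Hom.lin_dl (cosphereLift M (φ ∘ₗ M.dl a n' n)
        (fun j m => by rw [LinearMap.comp_apply, M.dl_dl, map_zero])) y i j m)
    (fun {x y} p q i h r m => by
      apply (codiskEquiv R a E hn y i).injective
      rw [codiskEquiv_act]
      simp only [LinearMap.comp_apply, LinearEquiv.coe_coe, LinearEquiv.apply_symm_apply,
        LinearMap.prod_apply, Function.prod, cosphereCoact_act])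

theorem codiskEval_lift (M : DGModule R) (φ : M.el a n →ₗ[k] E) (m : M.el a n) :
    codiskEval hn (codiskLift hn M φ) m = φ m := by
  change cosphereCoord 0 (zero_add n) (codiskEquiv R a E hn a n ((codiskEquiv R a E hn a n).symm
    (cosphereCoact M (φ ∘ₗ M.dl a n' n) a n m, cosphereCoact M φ a n m))).2 (R.id a) = φ m
  rw [LinearEquiv.apply_symm_apply, cosphereCoord_coact, M.id_act]

end Cosphere

end DGModule

/-! ### DG submodules and finite limits -/

namespace DGModule

variable {k : Type u} [CommRing k] {R : DGCat.{u} k}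

/-- A DG submodule. -/
structure Sub (M : DGModule R) where
  /-- the submodules -/
  S (x : R.Obj) (n : ℤ) : Submodule k (M.el x n)
  dl_mem (x : R.Obj) (i j : ℤ) (h : j + 1 = i) (m : M.el x i) (hm : m ∈ S x i) :
    M.dl x i j m ∈ S x j
  act_mem {x y : R.Obj} (p q n : ℤ) (h : p + q = n) (r : (R.Hom x y).X p) (m : M.el x q)
    (hm : m ∈ S x q) : M.act p q n h r m ∈ S y n

namespace Sub

variable {M N P : DGModule R} (S : Sub M)

/-- The raw data of a DG submodule. -/
def data : Data R where
  E x n := ModuleCat.of k (S.S x n)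
  d x i j h := (M.dl x i j).restrict (S.dl_mem x i j h)
  d_d x i j l h h' (m : S.S x i) := Subtype.ext (M.dl_dl x i j l m.1)
  act p q n h := LinearMap.mk₂ k (fun r (m : S.S _ q) => (⟨M.act p q n h r m, S.act_mem p q n h r m m.2⟩ : S.S _ n))
    (fun _ _ _ => Subtype.ext (by simp)) (fun _ _ _ => Subtype.ext (by simp))
    (fun _ _ _ => Subtype.ext (by simp)) (fun _ _ _ => Subtype.ext (by simp))
  id_act {x} q (m : S.S x q) := Subtype.ext (M.id_act q m.1)
  comp_act {x y z} p q r pq qr n h₁ h₂ h₃ h₄ g f (m : S.S x r) :=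
    Subtype.ext (M.comp_act p q r pq qr n h₁ h₂ h₃ h₄ g f m.1)
  d_act {x y} p q n p' q' n' h hp hq hn f (m : S.S x q) :=
    Subtype.ext (M.dl_act p q n p' q' n' h hp hq hn f m.1)

/-- A DG submodule as a DG module. -/
def toModule : DGModule R := S.data.toModule

/-- The inclusion of a DG submodule. -/
def incl : S.toModule ⟶ M :=
  Hom.ofLin (M := S.toModule) (fun x n => (S.S x n).subtype)
    (fun x i j h m => congrArg Subtype.val (S.data.toModule_dl x i j h m))
    (fun _ _ _ _ _ _ => rfl)

theorem incl_injective (x : R.Obj) (n : ℤ) : Function.Injective (Hom.lin S.incl x n) :=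
  Subtype.val_injective

instance : Mono S.incl := Hom.mono_of_injective _ S.incl_injective

theorem incl_mem (x : R.Obj) (n : ℤ) (m : S.toModule.el x n) : Hom.lin S.incl x n m ∈ S.S x n :=
  m.2

theorem exists_incl (x : R.Obj) (n : ℤ) (m : M.el x n) (hm : m ∈ S.S x n) :
    ∃ m', Hom.lin S.incl x n m' = m := ⟨⟨m, hm⟩, rfl⟩

variable {S} in
/-- The restriction of a morphism to a DG submodule of its target. -/
def lift (φ : N ⟶ M) (h : ∀ x n m, Hom.lin φ x n m ∈ S.S x n) : N ⟶ S.toModule :=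
  Hom.ofLin (N := S.toModule) (fun x n => (Hom.lin φ x n).codRestrict (S.S x n) (h x n))
    (fun x i j e m => S.incl_injective x j (by
      rw [Hom.lin_dl]
      exact Hom.lin_dl φ x i j m))
    (fun {x y} p q n e r m => S.incl_injective y n (by
      rw [Hom.lin_act]
      exact Hom.lin_act φ p q n e r m))

variable {S} in
theorem lift_incl (φ : N ⟶ M) (h) : S.lift φ h ≫ S.incl = φ := rfl

/-- The inverse image of a DG submodule. -/
def comap (φ : N ⟶ M) : Sub N where
  S x n := (S.S x n).comap (Hom.lin φ x n)
  dl_mem x i j h m hm := by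
    rw [Submodule.mem_comap, Hom.lin_dl]
    exact S.dl_mem x i j h _ hm
  act_mem p q n h r m hm := by
    rw [Submodule.mem_comap, Hom.lin_act]
    exact S.act_mem p q n h r _ hm

/-- The equalizer of two morphisms. -/
def eq (φ ψ : M ⟶ N) : Sub M where
  S x n := LinearMap.eqLocus (Hom.lin φ x n) (Hom.lin ψ x n)
  dl_mem x i j h m hm := by
    rw [LinearMap.mem_eqLocus] at hm ⊢
    rw [Hom.lin_dl, Hom.lin_dl, hm]
  act_mem p q n h r m hm := by
    rw [LinearMap.mem_eqLocus] at hm ⊢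
    rw [Hom.lin_act, Hom.lin_act, hm]

end Sub

/-- The product of two DG modules. -/
def prod (M N : DGModule R) : DGModule R :=
  Twist.toModule (A := M) (B := N) { δ := fun _ _ _ _ => 0, δ_dl := by simp, δ_act := by simp }

/-- The elements of a product. -/
def prodEquiv (M N : DGModule R) (x : R.Obj) (n : ℤ) : (prod M N).el x n ≃ₗ[k] M.el x n × N.el x n :=
  Twist.equiv _ x n

section Prod

variable {M N P : DGModule R}

theorem prodEquiv_dl (x : R.Obj) (i j : ℤ) (h : j + 1 = i) (m : (prod M N).el x i) :
    prodEquiv M N x j ((prod M N).dl x i j m) =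
      (M.dl x i j (prodEquiv M N x i m).1, N.dl x i j (prodEquiv M N x i m).2) :=
  (Twist.equiv_dl _ x i j h m).trans (Prod.ext rfl (zero_add _))

theorem prodEquiv_act {x y : R.Obj} (p q n : ℤ) (h : p + q = n) (r : (R.Hom x y).X p)
    (m : (prod M N).el x q) : prodEquiv M N y n ((prod M N).act p q n h r m) =
      (M.act p q n h r (prodEquiv M N x q m).1, N.act p q n h r (prodEquiv M N x q m).2) := rfl

variable (M N) in
/-- The first projection. -/
def prodFst : prod M N ⟶ M :=
  Hom.ofLin (fun x n => LinearMap.fst k _ _ ∘ₗ (prodEquiv M N x n).toLinearMap)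
    (fun x i j h m => by simp [prodEquiv_dl x i j h])
    (fun p q n h r m => by simp [prodEquiv_act])

variable (M N) in
/-- The second projection. -/
def prodSnd : prod M N ⟶ N :=
  Hom.ofLin (fun x n => LinearMap.snd k _ _ ∘ₗ (prodEquiv M N x n).toLinearMap)
    (fun x i j h m => by simp [prodEquiv_dl x i j h])
    (fun p q n h r m => by simp [prodEquiv_act])

theorem prod_ext {x : R.Obj} {n : ℤ} {m m' : (prod M N).el x n}
    (h : Hom.lin (prodFst M N) x n m = Hom.lin (prodFst M N) x n m')
    (h' : Hom.lin (prodSnd M N) x n m = Hom.lin (prodSnd M N) x n m') : m = m' :=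
  (prodEquiv M N x n).injective (Prod.ext h h')

/-- The morphism to a product. -/
def prodLift (φ : P ⟶ M) (ψ : P ⟶ N) : P ⟶ prod M N :=
  Hom.ofLin (fun x n => (prodEquiv M N x n).symm.toLinearMap ∘ₗ
      (Hom.lin φ x n).prod (Hom.lin ψ x n))
    (fun x i j h m => (prodEquiv M N x j).injective (by
      rw [prodEquiv_dl x i j h]
      exact Prod.ext (Hom.lin_dl φ x i j m) (Hom.lin_dl ψ x i j m)))
    (fun {x y} p q n h r m => (prodEquiv M N y n).injective (by
      rw [prodEquiv_act]
      exact Prod.ext (Hom.lin_act φ p q n h r m) (Hom.lin_act ψ p q n h r m)))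

theorem prodLift_fst (φ : P ⟶ M) (ψ : P ⟶ N) : prodLift φ ψ ≫ prodFst M N = φ := rfl

theorem prodLift_snd (φ : P ⟶ M) (ψ : P ⟶ N) : prodLift φ ψ ≫ prodSnd M N = ψ := rfl

end Prod

variable (R) in
/-- The zero DG module. -/
def zero : DGModule R := Data.toModule
  { E := fun _ _ => ModuleCat.of k PUnit.{u + 1}
    d := fun _ _ _ _ => 0
    d_d := fun _ _ _ _ _ _ _ => rfl
    act := fun _ _ _ _ => 0
    id_act := fun _ _ => rfl
    comp_act := fun _ _ _ _ _ _ _ _ _ _ _ _ _ => rfl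
    d_act := fun _ _ _ _ _ _ _ _ _ _ _ _ => rfl }

instance (x : R.Obj) (n : ℤ) : Subsingleton ((zero R).el x n) :=
  inferInstanceAs (Subsingleton PUnit.{u + 1})

/-- The morphism to the zero DG module. -/
def toZero (M : DGModule R) : M ⟶ zero R :=
  Hom.ofLin (fun _ _ => 0) (fun _ _ _ _ _ => Subsingleton.elim _ _)
    (fun _ _ _ _ _ _ => Subsingleton.elim _ _)

instance (M : DGModule R) : Subsingleton (M ⟶ zero R) :=
  ⟨fun _ _ => Hom.lin_ext fun _ _ _ => Subsingleton.elim _ _⟩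

instance : HasFiniteLimits (DGModule R) := by
  have : HasTerminal (DGModule R) := IsTerminal.hasTerminal (X := zero R)
    (IsTerminal.ofUniqueHom (fun M => toZero M) (fun _ _ => Subsingleton.elim _ _))
  have (M N : DGModule R) : HasLimit (pair M N) :=
    ⟨⟨⟨BinaryFan.mk (prodFst M N) (prodSnd M N), BinaryFan.isLimitMk
      (fun s => prodLift s.fst s.snd) (fun s => prodLift_fst _ _) (fun s => prodLift_snd _ _)
      (fun s m h h' => Hom.lin_ext fun x n t => prod_ext congr(Hom.lin $h x n t)
        congr(Hom.lin $h' x n t))⟩⟩⟩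
  have : HasBinaryProducts (DGModule R) := hasBinaryProducts_of_hasLimit_pair _
  have : HasFiniteProducts (DGModule R) := hasFiniteProducts_of_has_binary_and_terminal
  have {M N : DGModule R} (φ ψ : M ⟶ N) : HasLimit (parallelPair φ ψ) :=
    ⟨⟨⟨Fork.ofι (Sub.eq φ ψ).incl (Hom.lin_ext fun x n m => (Sub.eq φ ψ).incl_mem x n m),
      Fork.IsLimit.mk _ (fun s => Sub.lift s.ι fun x n m => congr(Hom.lin $(s.condition) x n m))
        (fun s => Sub.lift_incl _ _)
        (fun s m h => by
          rw [← cancel_mono (Sub.eq φ ψ).incl]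
          exact h)⟩⟩⟩
  have : HasEqualizers (DGModule R) := hasEqualizers_of_hasLimit_parallelPair _
  exact hasFiniteLimits_of_hasEqualizers_and_finite_products

end DGModule

/-! ### Degreewise colimits and local presentability -/

namespace DGModule

variable {k : Type u} [CommRing k] {R : DGCat.{u} k}

variable (R) in
/-- The evaluation of DG modules at an object, in one degree. -/
@[simps] def ev (x : R.Obj) (n : ℤ) : DGModule R ⥤ ModuleCat.{u} k where
  obj M := (M.cx x).X n
  map φ := ModuleCat.ofHom (Hom.lin φ x n)

section Colimit

variable {J : Type u} [Category.{u} J] (F : J ⥤ DGModule R)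

/-- The elements of a colimit of DG modules. -/
noncomputable abbrev colimEl (x : R.Obj) (n : ℤ) : ModuleCat.{u} k := colimit (F ⋙ ev R x n)

/-- The structure maps of a colimit of DG modules. -/
noncomputable def colimι (j : J) (x : R.Obj) (n : ℤ) : (F.obj j).el x n →ₗ[k] colimEl F x n :=
  (colimit.ι (F ⋙ ev R x n) j).hom

variable {F} in
theorem colimEl_ext {x : R.Obj} {n : ℤ} {P : Type u} [AddCommGroup P] [Module k P]
    {f g : colimEl F x n →ₗ[k] P} (h : ∀ j m, f (colimι F j x n m) = g (colimι F j x n m)) :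
    f = g :=
  congrArg ModuleCat.Hom.hom (colimit.hom_ext (f := ModuleCat.ofHom f) (f' := ModuleCat.ofHom g)
    fun j => ModuleCat.hom_ext (LinearMap.ext (h j)))

variable {F} in
theorem colimEl_ext' {x : R.Obj} {n : ℤ} {P : Type u} [AddCommGroup P] [Module k P]
    (f g : colimEl F x n →ₗ[k] P) (h : ∀ j m, f (colimι F j x n m) = g (colimι F j x n m))
    (m : colimEl F x n) : f m = g m :=
  congr($(colimEl_ext h) m)

theorem colimι_map {i j : J} (a : i ⟶ j) (x : R.Obj) (n : ℤ) (m : (F.obj i).el x n) :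
    colimι F j x n (Hom.lin (F.map a) x n m) = colimι F i x n m :=
  congr($(colimit.w (F ⋙ ev R x n) a).hom m)

/-- The cocone of a compatible family of linear maps. -/
@[simps] def evCocone {x : R.Obj} {n : ℤ} {P : Type u} [AddCommGroup P] [Module k P]
    (f : ∀ j, (F.obj j).el x n →ₗ[k] P)
    (hf : ∀ (i j : J) (a : i ⟶ j) m, f j (Hom.lin (F.map a) x n m) = f i m) :
    Cocone (F ⋙ ev R x n) where
  pt := ModuleCat.of k P
  ι :=
    { app := fun j => ModuleCat.ofHom (f j)
      naturality := fun i j a => ModuleCat.hom_ext (LinearMap.ext (hf i j a)) }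

/-- The linear map on a colimit of DG modules given by a compatible family of linear maps. -/
noncomputable def colimDesc {x : R.Obj} {n : ℤ} {P : Type u} [AddCommGroup P] [Module k P]
    (f : ∀ j, (F.obj j).el x n →ₗ[k] P)
    (hf : ∀ (i j : J) (a : i ⟶ j) m, f j (Hom.lin (F.map a) x n m) = f i m) :
    colimEl F x n →ₗ[k] P :=
  (colimit.desc (F ⋙ ev R x n) (evCocone F f hf)).hom

theorem colimDesc_ι {x : R.Obj} {n : ℤ} {P : Type u} [AddCommGroup P] [Module k P]
    (f : ∀ j, (F.obj j).el x n →ₗ[k] P) (hf) (j : J) (m : (F.obj j).el x n) :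
    colimDesc F f hf (colimι F j x n m) = f j m :=
  congr($(colimit.ι_desc (evCocone F f hf) j).hom m)

/-- The differential of a colimit of DG modules. -/
noncomputable def colimD (x : R.Obj) (i j : ℤ) : colimEl F x i →ₗ[k] colimEl F x j :=
  colimDesc F (fun l => colimι F l x j ∘ₗ (F.obj l).dl x i j) (fun l l' a m => by
    rw [LinearMap.comp_apply, LinearMap.comp_apply, ← Hom.lin_dl, colimι_map])

theorem colimD_ι (l : J) (x : R.Obj) (i j : ℤ) (m : (F.obj l).el x i) :
    colimD F x i j (colimι F l x i m) = colimι F l x j ((F.obj l).dl x i j m) :=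
  colimDesc_ι F _ _ l m

/-- The action of one element on a colimit of DG modules. -/
noncomputable def colimActOne {x y : R.Obj} (p q n : ℤ) (h : p + q = n) (r : (R.Hom x y).X p) :
    colimEl F x q →ₗ[k] colimEl F y n :=
  colimDesc F (fun l => colimι F l y n ∘ₗ (F.obj l).act p q n h r) (fun l l' a m => by
    rw [LinearMap.comp_apply, LinearMap.comp_apply, ← Hom.lin_act, colimι_map])

theorem colimActOne_ι {x y : R.Obj} (p q n : ℤ) (h : p + q = n) (r : (R.Hom x y).X p) (l : J)
    (m : (F.obj l).el x q) :
    colimActOne F p q n h r (colimι F l x q m) = colimι F l y n ((F.obj l).act p q n h r m) :=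
  colimDesc_ι F (fun l => colimι F l y n ∘ₗ (F.obj l).act p q n h r) _ l m

/-- The action on a colimit of DG modules. -/
noncomputable def colimAct {x y : R.Obj} (p q n : ℤ) (h : p + q = n) :
    (R.Hom x y).X p →ₗ[k] colimEl F x q →ₗ[k] colimEl F y n where
  toFun := colimActOne F p q n h
  map_add' r s := colimEl_ext fun l m => by simp [colimActOne_ι]
  map_smul' c r := colimEl_ext fun l m => by simp [colimActOne_ι]

theorem colimAct_ι {x y : R.Obj} (p q n : ℤ) (h : p + q = n) (r : (R.Hom x y).X p) (l : J)
    (m : (F.obj l).el x q) :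
    colimAct F p q n h r (colimι F l x q m) = colimι F l y n ((F.obj l).act p q n h r m) :=
  colimActOne_ι F p q n h r l m

/-- The raw data of a colimit of DG modules. -/
noncomputable def colimData : Data R where
  E := colimEl F
  d x i j _ := colimD F x i j
  d_d x i j l _ _ := colimEl_ext' (colimD F x j l ∘ₗ colimD F x i j) 0 fun s m => by
    rw [LinearMap.comp_apply, colimD_ι, colimD_ι, dl_dl, map_zero, LinearMap.zero_apply]
  act := colimAct F
  id_act {x} q := colimEl_ext' (colimAct F 0 q q (zero_add q) (R.id x)) LinearMap.id fun s m => by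
    rw [colimAct_ι, id_act, LinearMap.id_apply]
  comp_act p q r pq qr n h₁ h₂ h₃ h₄ g f :=
    colimEl_ext' (colimAct F pq r n h₃ (R.comp p q pq h₁ g f))
      (colimAct F p qr n h₄ g ∘ₗ colimAct F q r qr h₂ f) fun s m => by
    rw [LinearMap.comp_apply, colimAct_ι, colimAct_ι, colimAct_ι,
      (F.obj s).comp_act p q r pq qr n h₁ h₂ h₃ h₄]
  d_act {x y} p q n p' q' n' h hp hq hn f :=
    colimEl_ext' (colimD F y n n' ∘ₗ colimAct F p q n h f)
      (colimAct F p' q n' (by omega) ((R.Hom x y).d p p' f) +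
        p.negOnePow • (colimAct F p q' n' (by omega) f ∘ₗ colimD F x q q')) fun s m => by
    rw [LinearMap.comp_apply, LinearMap.add_apply, LinearMap.smul_apply, LinearMap.comp_apply,
      colimAct_ι, colimAct_ι, colimD_ι, colimD_ι, colimAct_ι,
      (F.obj s).dl_act p q n p' q' n' h hp hq hn, map_add, Units.smul_def, Units.smul_def,
      map_zsmul]

/-- The colimit cocone of a diagram of DG modules. -/
noncomputable def colimCocone : Cocone F where
  pt := (colimData F).toModule
  ι :=
    { app := fun l => Hom.ofLin (N := (colimData F).toModule) (colimι F l)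
        (fun x i j h m => (((colimData F).toModule_dl x i j h _).trans (colimD_ι F l x i j m)).symm)
        (fun p q n h r m => (colimAct_ι F p q n h r l m).symm)
      naturality := fun _ _ a => Hom.lin_ext fun x n m => colimι_map F a x n m }

/-- A component of a cocone. -/
def leg {F : J ⥤ DGModule R} (s : Cocone F) (l : J) : F.obj l ⟶ s.pt := s.ι.app l

theorem map_leg {F : J ⥤ DGModule R} (s : Cocone F) {i j : J} (a : i ⟶ j) (x : R.Obj) (n : ℤ)
    (m : (F.obj i).el x n) :
    Hom.lin (leg s j) x n (Hom.lin (F.map a) x n m) = Hom.lin (leg s i) x n m :=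
  congr(Hom.lin $(s.w a) x n m)

/-- The linear maps of the morphism from the colimit to the point of a cocone. -/
noncomputable def colimDescLin (s : Cocone F) (x : R.Obj) (n : ℤ) :
    (colimCocone F).pt.el x n →ₗ[k] s.pt.el x n :=
  colimDesc F (fun l => Hom.lin (leg s l) x n) (fun _ _ a m => map_leg s a x n m)

theorem colimDescLin_ι (s : Cocone F) (x : R.Obj) (n : ℤ) (l : J) (m : (F.obj l).el x n) :
    colimDescLin F s x n (Hom.lin (leg (colimCocone F) l) x n m) = Hom.lin (leg s l) x n m :=
  colimDesc_ι F (fun l => Hom.lin (leg s l) x n) (fun _ _ a m => map_leg s a x n m) l m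

theorem colim_ext {x : R.Obj} {n : ℤ} {P : Type u} [AddCommGroup P] [Module k P]
    (f g : (colimCocone F).pt.el x n →ₗ[k] P) (h : ∀ j m,
      f (Hom.lin (leg (colimCocone F) j) x n m) = g (Hom.lin (leg (colimCocone F) j) x n m))
    (m : (colimCocone F).pt.el x n) : f m = g m :=
  colimEl_ext' f g h m

/-- The colimit cocone of a diagram of DG modules is a colimit cocone. -/
noncomputable def isColimitColimCocone : IsColimit (colimCocone F) where
  desc s := Hom.ofLin (colimDescLin F s)
    (fun x i j h m => by
      refine colim_ext F (colimDescLin F s x j ∘ₗ dl _ x i j)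
        (s.pt.dl x i j ∘ₗ colimDescLin F s x i) (fun l m => ?_) m
      rw [LinearMap.comp_apply, LinearMap.comp_apply, ← Hom.lin_dl, colimDescLin_ι,
        colimDescLin_ι, Hom.lin_dl])
    (fun {x y} p q n h r m => by
      refine colim_ext F (colimDescLin F s y n ∘ₗ act _ p q n h r)
        (s.pt.act p q n h r ∘ₗ colimDescLin F s x q) (fun l m => ?_) m
      rw [LinearMap.comp_apply, LinearMap.comp_apply, ← Hom.lin_act, colimDescLin_ι,
        colimDescLin_ι, Hom.lin_act])
  fac s l := Hom.lin_ext fun x n m => colimDescLin_ι F s x n l m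
  uniq s _ h := Hom.lin_ext fun x n => colim_ext F _ (colimDescLin F s x n)
    fun l m => congr(Hom.lin $(h l) x n m).trans (colimDescLin_ι F s x n l m).symm

/-- The evaluations preserve the colimit cocone. -/
noncomputable def isColimitEvColimCocone (x : R.Obj) (n : ℤ) :
    IsColimit ((ev R x n).mapCocone (colimCocone F)) :=
  IsColimit.ofIsoColimit (colimit.isColimit (F ⋙ ev R x n))
    (Cocone.ext (Iso.refl _) (fun _ => rfl))

end Colimit

instance : HasColimitsOfSize.{u, u} (DGModule R) where
  has_colimits_of_shape _ _ := { has_colimit := fun F => ⟨⟨_, isColimitColimCocone F⟩⟩ }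

instance (x : R.Obj) (n : ℤ) : PreservesColimitsOfSize.{u, u} (ev R x n) where
  preservesColimitsOfShape := ⟨fun {F} => preservesColimit_of_preserves_colimit_cocone
    (isColimitColimCocone F) (isColimitEvColimCocone F x n)⟩

instance : HasFiniteColimits (DGModule R) := hasFiniteColimits_of_hasColimitsOfSize _

/-- A free DG module represents an evaluation. -/
def coyonedaFree {n n' : ℤ} (hn : n + 1 = n') (a : R.Obj) :
    coyoneda.obj (Opposite.op (free R a hn)) ≅ ev R a n' ⋙ forget (ModuleCat.{u} k) :=
  NatIso.ofComponents (fun M => Equiv.toIso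
    { toFun := fun φ => Hom.lin φ a n' (freeUnit R a hn)
      invFun := fun m => M.freeDesc hn m
      left_inv := fun _ => free_hom_ext hn (M.freeDesc_unit hn _)
      right_inv := fun m => M.freeDesc_unit hn m }) (fun _ => rfl)

-- The functor represented by a free module is an evaluation followed by the forgetful functor, and
-- both preserve filtered colimits.
attribute [local instance] Cardinal.fact_isRegular_aleph0 in
theorem isCardinalPresentable_free {n n' : ℤ} (hn : n + 1 = n') (a : R.Obj) :
    IsCardinalPresentable (free R a hn) Cardinal.aleph0.{u} where
  preservesColimitOfShape J _ _ := by
    have := isFiltered_of_isCardinalFiltered J Cardinal.aleph0.{u}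
    have : PreservesColimitsOfShape J (forget (ModuleCat.{u} k)) :=
      PreservesFilteredColimitsOfSize.preserves_filtered_colimits J
    exact preservesColimitsOfShape_of_natIso (coyonedaFree hn a).symm

variable (R) in
/-- The free DG modules on an element. -/
def frees : ObjectProperty (DGModule R) :=
  .ofObj fun i : R.Obj × ℤ => free R i.1 (sub_add_cancel i.2 1)

/-- Maps out of free modules are elements: they separate morphisms, and a monomorphism through which
all of them factor is also surjective. -/
theorem isStrongGenerator_frees : (frees R).IsStrongGenerator := by
  rw [ObjectProperty.isStrongGenerator_iff]
  refine ⟨fun M N φ ψ h => Hom.lin_ext fun x n m => ?_, fun M N i _ h =>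
    Hom.isIso_of_bijective i fun x n => ⟨Hom.injective_of_mono i x n, fun m => ?_⟩⟩
  · have := h _ (ObjectProperty.ofObj_apply _ (x, n)) (M.freeDesc (sub_add_cancel n 1) m)
    rw [← M.freeDesc_unit (sub_add_cancel n 1) m, ← Hom.lin_comp, this, Hom.lin_comp]
  · obtain ⟨f, hf⟩ := h _ (ObjectProperty.ofObj_apply _ (x, n)) (N.freeDesc (sub_add_cancel n 1) m)
    refine ⟨Hom.lin f x n (freeUnit R x _), ?_⟩
    rw [← Hom.lin_comp]
    exact (congr(Hom.lin $hf x n _)).trans (N.freeDesc_unit _ m)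

attribute [local instance] Cardinal.fact_isRegular_aleph0 in
instance : IsLocallyPresentable.{u} (DGModule R) where
  exists_cardinal := ⟨Cardinal.aleph0, inferInstance,
    (IsCardinalLocallyPresentable.iff_exists_isStrongGenerator _ _).2
      ⟨frees R, by unfold frees; infer_instance, isStrongGenerator_frees, by
        rintro _ ⟨i⟩
        exact isCardinalPresentable_free _ _⟩⟩

end DGModule

/-! ### Quasi-isomorphisms in terms of elements -/

section Refinements

variable {k : Type u} [CommRing k]

/-- A choice of elements is rarely linear, but it becomes linear on the free module on the set `A`,
which covers `A`. This converts elementwise solutions into solutions up to refinement. -/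
theorem ModuleCat.exists_epi_of_choice {A B : ModuleCat.{u} k} (c : A → B) :
    ∃ (A' : ModuleCat.{u} k) (π : A' ⟶ A) (_ : Epi π) (f : A' ⟶ B) (s : A → A'),
      (∀ a, π (s a) = a) ∧ (∀ a, f (s a) = c a) ∧
      ∀ {Q : ModuleCat.{u} k} (g g' : A' ⟶ Q), (∀ a, g (s a) = g' (s a)) → g = g' := by
  have h : ∀ a, (Finsupp.linearCombination k (id : A → A)) (Finsupp.single a 1) = a := by simp
  refine ⟨ModuleCat.of k (A →₀ k), ModuleCat.ofHom (Finsupp.linearCombination k id),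
    (ModuleCat.epi_iff_surjective _).2 fun a => ⟨_, h a⟩,
    ModuleCat.ofHom (Finsupp.linearCombination k c), fun a => Finsupp.single a 1, h, ?_, ?_⟩
  · intro a
    exact (Finsupp.linearCombination_single k 1 a).trans (one_smul k _)
  · intro Q g g' hg
    refine ModuleCat.hom_ext (Finsupp.lhom_ext' fun a => LinearMap.ext_ring ?_)
    exact hg a

theorem ModuleCat.exists_apply_eq_one {A' : ModuleCat.{u} k}
    (π : A' ⟶ ModuleCat.of k k) [Epi π] : ∃ a : A', π a = (1 : k) :=
  (ModuleCat.epi_iff_surjective π).1 inferInstance 1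

/-- The map from the free module of rank one given by an element. -/
abbrev ModuleCat.ofEl {A : ModuleCat.{u} k} (a : A) : ModuleCat.of k k ⟶ A :=
  ModuleCat.ofHom (LinearMap.toSpanSingleton k A a)

variable {K L : ChainComplex (ModuleCat.{u} k) ℤ} (φ : K ⟶ L)

/-- The criterion up to refinements, tested on maps from `k` in one direction; in the other, chosen
primitives are linearized on a free cover. -/
theorem ChainComplex.mono_homologyMap_iff (i j l : ℤ) (hi : j + 1 = i) (hl : l + 1 = j) :
    Mono (HomologicalComplex.homologyMap φ j) ↔
      ∀ (x : K.X j) (y : L.X i), K.d j l x = 0 → φ.f j x = L.d i j y → ∃ x', x = K.d i j x' := by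
  rw [HomologicalComplex.mono_homologyMap_iff_up_to_refinements φ i j l
    (ComplexShape.prev_eq' _ hi) (ComplexShape.next_eq' _ hl)]
  constructor
  · intro h x y hx hxy
    obtain ⟨A', π, _, x₁, e⟩ := h (ModuleCat.ofEl x)
      (ModuleCat.hom_ext (LinearMap.ext_ring (by simpa using hx))) (ModuleCat.ofEl y)
      (ModuleCat.hom_ext (LinearMap.ext_ring (by simpa using hxy)))
    obtain ⟨a, ha⟩ := ModuleCat.exists_apply_eq_one π
    have := congr($e a)
    exact ⟨x₁ a, by simpa [ha] using this⟩
  · intro h A x hx y hxy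
    choose c hc using fun a : A => h (x a) (y a) congr($hx a) congr($hxy a)
    obtain ⟨A', π, hπ, f, s, h₁, h₂, h₃⟩ := ModuleCat.exists_epi_of_choice c
    exact ⟨A', π, hπ, f, h₃ _ _ fun a => by simp [h₁, h₂, ← hc]⟩

theorem ChainComplex.epi_homologyMap_iff (i j l : ℤ) (hi : j + 1 = i) (hl : l + 1 = j) :
    Epi (HomologicalComplex.homologyMap φ j) ↔
      ∀ (y : L.X j), L.d j l y = 0 → ∃ x y', K.d j l x = 0 ∧ y = φ.f j x + L.d i j y' := by
  rw [HomologicalComplex.epi_homologyMap_iff_up_to_refinements φ i j l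
    (ComplexShape.prev_eq' _ hi) (ComplexShape.next_eq' _ hl)]
  constructor
  · intro h y hy
    obtain ⟨A', π, _, x₂, hx₂, y₁, e⟩ := h (ModuleCat.ofEl y)
      (ModuleCat.hom_ext (LinearMap.ext_ring (by simpa using hy)))
    obtain ⟨a, ha⟩ := ModuleCat.exists_apply_eq_one π
    have := congr($e a)
    exact ⟨x₂ a, y₁ a, congr($hx₂ a), by simpa [ha] using this⟩
  · intro h A y hy
    choose c hc using fun a : A => h (y a) congr($hy a)
    choose c' hc' using hc
    let B := ModuleCat.of k (K.X j × L.X i)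
    obtain ⟨A', π, hπ, f, s, h₁, h₂, h₃⟩ := ModuleCat.exists_epi_of_choice
      (B := B) fun a => (c a, c' a)
    have e₁ : ∀ a, (f ≫ ModuleCat.ofHom (LinearMap.fst k (K.X j) (L.X i))) (s a) = c a :=
      fun a => congrArg Prod.fst (h₂ a)
    have e₂ : ∀ a, (f ≫ ModuleCat.ofHom (LinearMap.snd k (K.X j) (L.X i))) (s a) = c' a :=
      fun a => congrArg Prod.snd (h₂ a)
    refine ⟨A', π, hπ, f ≫ ModuleCat.ofHom (LinearMap.fst k _ _), h₃ _ _ fun a => ?_,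
      f ≫ ModuleCat.ofHom (LinearMap.snd k _ _), h₃ _ _ fun a => ?_⟩
    · rw [ConcreteCategory.comp_apply, e₁, (hc' a).1]
      rfl
    · rw [ConcreteCategory.comp_apply, h₁]
      refine (hc' a).2.trans ?_
      rw [← e₁, ← e₂]
      rfl

end Refinements

namespace DGModule

variable {k : Type u} [CommRing k] {R : DGCat.{u} k} {M N : DGModule R} (φ : M ⟶ N)

theorem objectwiseQuasiIso_iff : objectwiseQuasiIso R φ ↔ ∀ x i j l, j + 1 = i → l + 1 = j →
    (∀ (m : M.el x j) (y : N.el x i), M.dl x j l m = 0 → Hom.lin φ x j m = N.dl x i j y →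
      ∃ m', m = M.dl x i j m') ∧
    (∀ y : N.el x j, N.dl x j l y = 0 → ∃ m y', M.dl x j l m = 0 ∧
      y = Hom.lin φ x j m + N.dl x i j y') := by
  constructor
  · intro h x i j l hi hl
    have := h x
    have : IsIso (HomologicalComplex.homologyMap (Hom.app φ x) j) := inferInstance
    exact ⟨(ChainComplex.mono_homologyMap_iff _ i j l hi hl).1 inferInstance,
      (ChainComplex.epi_homologyMap_iff _ i j l hi hl).1 inferInstance⟩
  · intro h x
    refine ⟨fun j => ?_⟩
    rw [quasiIsoAt_iff_isIso_homologyMap]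
    obtain ⟨h₁, h₂⟩ := h x (j + 1) j (j - 1) rfl (by omega)
    have := (ChainComplex.mono_homologyMap_iff (Hom.app φ x) (j + 1) j (j - 1) rfl (by omega)).2 h₁
    have := (ChainComplex.epi_homologyMap_iff (Hom.app φ x) (j + 1) j (j - 1) rfl (by omega)).2 h₂
    exact isIso_of_mono_of_epi _

/-- The cokernel of a morphism is acyclic. -/
def Hom.CokernelAcyclic : Prop :=
  ∀ x i j l, j + 1 = i → l + 1 = j → ∀ (y : N.el x j) (m : M.el x l),
    N.dl x j l y = Hom.lin φ x l m → ∃ m' y', y = Hom.lin φ x j m' + N.dl x i j y'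

/-- The long exact sequence of `M → N → N / M`, chased by hand so that the quotient need not be
formed. -/
theorem objectwiseQuasiIso_iff_of_injective (h : ∀ x n, Function.Injective (Hom.lin φ x n)) :
    objectwiseQuasiIso R φ ↔ Hom.CokernelAcyclic φ := by
  rw [objectwiseQuasiIso_iff]
  constructor
  · intro H x i j l hi hl y m hy
    have hm : M.dl x l (l - 1) m = 0 := h x _ (by rw [Hom.lin_dl, ← hy, dl_dl, map_zero])
    obtain ⟨m', rfl⟩ := (H x j l (l - 1) hl (by omega)).1 m y hm hy.symm
    obtain ⟨m₁, y', -, e⟩ := (H x i j l hi hl).2 (y - Hom.lin φ x j m')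
      (by rw [map_sub, hy, Hom.lin_dl, sub_self])
    exact ⟨m' + m₁, y', by rw [map_add, add_assoc, ← e, add_sub_cancel]⟩
  · intro H x i j l hi hl
    refine ⟨fun m y hm e => ?_, fun y hy => ?_⟩
    · obtain ⟨m', y', rfl⟩ := H x (i + 1) i j rfl hi y m e.symm
      refine ⟨m', h x j ?_⟩
      rw [e, map_add, dl_dl, add_zero, Hom.lin_dl]
    · obtain ⟨m', y', rfl⟩ := H x i j l hi hl y 0 (by rw [hy, map_zero])
      refine ⟨m', y', h x l ?_, rfl⟩
      rw [map_add, dl_dl, add_zero, ← Hom.lin_dl] at hy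
      rw [hy, map_zero]

/-- A morphism with a strong form of lifting is a quasi-isomorphism. -/
theorem objectwiseQuasiIso_of_lift (H : ∀ x i j, j + 1 = i → ∀ (e : M.el x j) (b : N.el x i),
    (∀ l, M.dl x j l e = 0) → Hom.lin φ x j e = N.dl x i j b →
      ∃ e', M.dl x i j e' = e ∧ Hom.lin φ x i e' = b) : objectwiseQuasiIso R φ := by
  rw [objectwiseQuasiIso_iff]
  intro x i j l hi hl
  refine ⟨fun m y hm e => ?_, fun y hy => ?_⟩
  · have hm' (l') : M.dl x j l' m = 0 := by
      by_cases hl' : l' + 1 = j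
      · obtain rfl : l' = l := by omega
        exact hm
      · rw [dl_shape _ _ _ _ hl', LinearMap.zero_apply]
    obtain ⟨e', h, -⟩ := H x i j hi m y hm' e
    exact ⟨e', h.symm⟩
  -- Lifting over `e = 0` yields a preimage that is itself a cycle.
  · obtain ⟨e', h, rfl⟩ := H x j l hl 0 y (fun _ => map_zero _) (by rw [hy, map_zero])
    exact ⟨e', 0, h, by rw [map_zero, add_zero]⟩

instance : (objectwiseQuasiIso R).HasTwoOutOfThreeProperty where
  comp_mem _ _ hf hg x := by
    have := hf x; have := hg x
    exact quasiIso_comp _ _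
  of_postcomp f g hg hfg x := by
    have := hg x
    exact (quasiIso_iff_comp_right (Hom.app f x) (Hom.app g x)).1 (hfg x)
  of_precomp f g hf hfg x := by
    have := hf x
    exact (quasiIso_iff_comp_left (Hom.app f x) (Hom.app g x)).1 (hfg x)

end DGModule

/-! ### Monomorphisms and acyclic cokernels detected by cofree modules -/

theorem ModuleCat.exists_extension {k : Type u} [CommRing k] {A Y : Type u} [AddCommGroup A]
    [Module k A] [AddCommGroup Y] [Module k Y] (E : ModuleCat.{u} k) [Injective E]
    (g : A →ₗ[k] Y) (h : A →ₗ[k] E) (hgh : ∀ a, g a = 0 → h a = 0) :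
    ∃ f : Y →ₗ[k] E, ∀ a, f (g a) = h a := by
  -- `h` factors through the image of `g`, so only the inclusion of that image has to be monic.
  obtain ⟨l, hl⟩ := LinearMap.exists_desc_of_surjective g.rangeRestrict
    g.surjective_rangeRestrict h (fun a ha => hgh a congr(Subtype.val $ha))
  let i : ModuleCat.of k (LinearMap.range g) ⟶ ModuleCat.of k Y :=
    ModuleCat.ofHom (LinearMap.range g).subtype
  have : Mono i := (ModuleCat.mono_iff_injective i).2 Subtype.val_injective
  refine ⟨(Injective.factorThru (ModuleCat.ofHom l) i).hom, fun a => ?_⟩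
  exact congr($(Injective.comp_factorThru (ModuleCat.ofHom l) i) (g.rangeRestrict a)).trans (hl a)

namespace DGModule

variable {k : Type u} [CommRing k] {R : DGCat.{u} k}

variable (R) in
/-- The monomorphisms, with acyclic cokernel if `b` holds. -/
def monoWith (b : Prop) : MorphismProperty (DGModule R) := fun _ _ φ =>
  (∀ x n, Function.Injective (Hom.lin φ x n)) ∧ (b → Hom.CokernelAcyclic φ)

theorem monoWith_false : monoWith R False = MorphismProperty.monomorphisms (DGModule R) := by
  ext M N φ
  rw [MorphismProperty.monomorphisms.iff, Hom.mono_iff_injective]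
  exact ⟨fun h => h.1, fun h => ⟨h, False.elim⟩⟩

theorem monoWith_true :
    monoWith R True = MorphismProperty.monomorphisms (DGModule R) ⊓ objectwiseQuasiIso R := by
  ext M N φ
  rw [MorphismProperty.inf_iff, MorphismProperty.monomorphisms.iff, Hom.mono_iff_injective]
  exact ⟨fun h => ⟨h.1, (objectwiseQuasiIso_iff_of_injective φ h.1).2 (h.2 trivial)⟩,
    fun h => ⟨h.1, fun _ => (objectwiseQuasiIso_iff_of_injective φ h.1).1 h.2⟩⟩

variable (R) in
/-- The morphisms between cofree DG modules on injective `k`-modules that detect monomorphisms,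
with acyclic cokernel if `b` holds. -/
inductive cofreeTests (b : Prop) : MorphismProperty (DGModule R)
  | disk (a : R.Obj) (n : ℤ) (E : ModuleCat.{u} k) [Injective E] :
      cofreeTests b (toZero (codisk R a E (n := n) rfl))
  | sphere (hb : b) (a : R.Obj) (n : ℤ) (E : ModuleCat.{u} k) [Injective E] :
      cofreeTests b (codiskToCosphere R a E (n := n) rfl)

/-- A lift to `codisk` extends a functional along the injection `φ`. Over `cosphere` the functional
is prescribed both on the image of `φ` and on boundaries; acyclicity of the cokernel makes the two
prescriptions agree. -/
theorem monoWith_le_llp (b : Prop) : monoWith R b ≤ (cofreeTests R b).llp := by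
  rintro M N φ ⟨h₁, h₂⟩ _ _ _ (⟨a, n, E⟩ | ⟨hb, a, n, E⟩)
  · refine ⟨fun {u v} sq => ?_⟩
    obtain ⟨f, hf⟩ := ModuleCat.exists_extension E (Hom.lin φ a n) (codiskEval rfl u)
      (fun m hm => by rw [h₁ a n (hm.trans (map_zero _).symm), map_zero])
    refine ⟨⟨⟨codiskLift rfl N f, codisk_hom_ext rfl fun m => ?_, Subsingleton.elim _ _⟩⟩⟩
    exact (codiskEval_lift rfl N f (Hom.lin φ a n m)).trans (hf m)
  · refine ⟨fun {u v} sq => ?_⟩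
    have huv (m : M.el a (n + 1)) :
        cosphereEval v (Hom.lin φ a (n + 1) m) = codiskEval rfl u (M.dl a (n + 1) n m) := by
      rw [← cosphereEval_codisk, sq.w]
      rfl
    obtain ⟨f, hf⟩ := ModuleCat.exists_extension E
      ((Hom.lin φ a n).coprod (N.dl a (n + 1) n)) ((codiskEval rfl u).coprod (cosphereEval v))
      (fun ⟨m, y⟩ h => by
        rw [LinearMap.coprod_apply] at h ⊢
        -- If `φ m + dy = 0`, then `y = φ m' + dy'` by acyclicity and `m = -dm'` by injectivity, so
        -- the values prescribed for `m` and `y` cancel.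
        obtain ⟨m', y', rfl⟩ := h₂ hb a (n + 1 + 1) (n + 1) n rfl rfl y (-m)
          (by rw [map_neg]; exact eq_neg_of_add_eq_zero_right h)
        rw [map_add, dl_dl, add_zero, ← Hom.lin_dl, ← map_add] at h
        rw [map_add, cosphereEval_dl, add_zero, huv, ← map_add,
          h₁ a n (h.trans (map_zero _).symm), map_zero])
    refine ⟨⟨⟨codiskLift rfl N f, codisk_hom_ext rfl fun m => ?_, cosphere_hom_ext fun y => ?_⟩⟩⟩
    · refine (codiskEval_lift rfl N f (Hom.lin φ a n m)).trans ?_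
      simpa using hf (m, 0)
    · rw [cosphereEval_codisk, codiskEval_lift]
      simpa using hf (0, y)

/-- Embeddings into injective modules provide enough functionals: one on `M` that is nonzero on any
nonzero `m`, and one on `N` whose kernel is exactly `φ M + dN`. -/
theorem llp_le_monoWith (b : Prop) : (cofreeTests R b).llp ≤ monoWith R b := by
  intro M N φ hφ
  have h₁ (a n) : Function.Injective (Hom.lin φ a n) := by
    rw [injective_iff_map_eq_zero]
    intro m hm
    let E := Injective.under (ModuleCat.of k (M.el a n))
    let ι : ModuleCat.of k (M.el a n) ⟶ E := Injective.ι _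
    have := hφ _ (cofreeTests.disk a n E)
    have sq : CommSq (codiskLift rfl M ι.hom) φ (toZero (codisk R a E (n := n) rfl)) (toZero N) :=
      ⟨Subsingleton.elim _ _⟩
    have e : codiskEval rfl (φ ≫ sq.lift) m = ι m := by
      rw [sq.fac_left]
      exact codiskEval_lift _ _ _ _
    have e' : codiskEval rfl (φ ≫ sq.lift) m = codiskEval rfl sq.lift (Hom.lin φ a n m) := rfl
    rw [e', hm, map_zero] at e
    exact (ModuleCat.mono_iff_injective ι).1 inferInstance (e.symm.trans (map_zero ι.hom).symm)
  refine ⟨h₁, fun hb a i j n hi hj y m hy => ?_⟩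
  subst hi hj
  let S : Submodule k (N.el a (n + 1)) :=
    LinearMap.range (Hom.lin φ a (n + 1)) ⊔ LinearMap.range (N.dl a (n + 1 + 1) (n + 1))
  let E := Injective.under (ModuleCat.of k (N.el a (n + 1) ⧸ S))
  let ι : ModuleCat.of k (N.el a (n + 1) ⧸ S) ⟶ E := Injective.ι _
  let ψ : N.el a (n + 1) →ₗ[k] E := ι.hom ∘ₗ S.mkQ
  have hψ {z} (hz : z ∈ S) : ψ z = 0 := by
    change ι.hom (S.mkQ z) = 0
    rw [Submodule.mkQ_apply, (Submodule.Quotient.mk_eq_zero S).2 hz, map_zero]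
  have hψ' (z) (hz : ψ z = 0) : z ∈ S :=
    (Submodule.Quotient.mk_eq_zero S).1 ((ModuleCat.mono_iff_injective ι).1 inferInstance
      (hz.trans (map_zero ι.hom).symm))
  have hψd (j) (z : N.el a j) : ψ (N.dl a j (n + 1) z) = 0 := by
    by_cases h : n + 1 + 1 = j
    · subst h
      exact hψ (Submodule.mem_sup_right ⟨z, rfl⟩)
    · rw [dl_shape _ _ _ _ h, LinearMap.zero_apply, map_zero]
  have := hφ _ (cofreeTests.sphere hb a n E)
  have sq : CommSq (codiskLift rfl M 0) φ (codiskToCosphere R a E (n := n) rfl)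
      (cosphereLift N ψ hψd) := ⟨by
    refine cosphere_hom_ext fun z => ?_
    rw [cosphereEval_codisk, codiskEval_lift, LinearMap.zero_apply]
    refine Eq.trans ?_ (cosphereEval_lift N ψ hψd (Hom.lin φ a (n + 1) z)).symm
    exact (hψ (Submodule.mem_sup_left ⟨z, rfl⟩)).symm⟩
  -- The lift writes `ψ` as a functional composed with `d`. As `dy = φ m`, the value at `y` is that
  -- of the lift on `φ m`, where it restricts to `0`.
  have e : ψ y = 0 := by
    rw [← cosphereEval_lift N ψ hψd, ← sq.fac_right, cosphereEval_codisk, hy]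
    refine (congr(codiskEval rfl $(sq.fac_left) m)).trans ?_
    rw [codiskEval_lift, LinearMap.zero_apply]
  obtain ⟨_, ⟨m', rfl⟩, _, ⟨y', rfl⟩, rfl⟩ := Submodule.mem_sup.1 (hψ' y e)
  exact ⟨m', y', rfl⟩

/-- The monomorphisms, with acyclic cokernel if `b` holds, are saturated. -/
theorem llp_rlp_le_monoWith {b : Prop} {W : MorphismProperty (DGModule R)} (h : W ≤ monoWith R b) :
    W.rlp.llp ≤ monoWith R b := by
  refine le_trans (MorphismProperty.antitone_llp ?_) (llp_le_monoWith b)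
  rw [← MorphismProperty.le_llp_iff_le_rlp]
  exact h.trans (monoWith_le_llp b)

end DGModule

/-! ### Bounded DG modules and the generating sets -/

namespace DGModule

variable {k : Type u} [CommRing k] {R : DGCat.{u} k}

variable (R) in
/-- The terms in one variable of degree `n₀` at `x₀`, built from the operations of DG modules over
`R` and one additional operation of degree `1`. -/
inductive Term (x₀ : R.Obj) (n₀ : ℤ) : R.Obj → ℤ → Type u
  | gen : Term x₀ n₀ x₀ n₀
  | zero (x : R.Obj) (n : ℤ) : Term x₀ n₀ x n
  | add {x : R.Obj} {n : ℤ} (s t : Term x₀ n₀ x n) : Term x₀ n₀ x n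
  | smul {x : R.Obj} {n : ℤ} (c : k) (t : Term x₀ n₀ x n) : Term x₀ n₀ x n
  | d {x : R.Obj} (i j : ℤ) (t : Term x₀ n₀ x i) : Term x₀ n₀ x j
  | act {x y : R.Obj} (p q n : ℤ) (h : p + q = n) (r : (R.Hom x y).X p) (t : Term x₀ n₀ x q) :
      Term x₀ n₀ y n
  | op {x : R.Obj} (i : ℤ) (t : Term x₀ n₀ x i) : Term x₀ n₀ x (i + 1)

section

variable {Y : DGModule R} (w : ∀ x i, Y.el x i → Y.el x (i + 1)) {x₀ : R.Obj} {n₀ : ℤ}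
  (y : Y.el x₀ n₀)

/-- The values of terms. -/
def Term.eval : ∀ {x n}, Term R x₀ n₀ x n → Y.el x n
  | _, _, .gen => y
  | _, _, .zero _ _ => 0
  | _, _, .add s t => s.eval + t.eval
  | _, _, .smul c t => c • t.eval
  | _, _, .d i j t => Y.dl _ i j t.eval
  | _, _, .act p q n h r t => Y.act p q n h r t.eval
  | _, _, .op i t => w _ i t.eval

/-- The DG submodule generated by an element under an additional operation. -/
def closureSub : Sub Y where
  S x n :=
    -- Terms include all module operations, so their values already form a submodule and no span is
    -- taken.
    { carrier := Set.range (Term.eval w y (x := x) (n := n))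
      zero_mem' := ⟨.zero x n, rfl⟩
      add_mem' := by
        rintro _ _ ⟨s, rfl⟩ ⟨t, rfl⟩
        exact ⟨.add s t, rfl⟩
      smul_mem' := by
        rintro c _ ⟨t, rfl⟩
        exact ⟨.smul c t, rfl⟩ }
  dl_mem := by
    rintro x i j _ _ ⟨t, rfl⟩
    exact ⟨.d i j t, rfl⟩
  act_mem := by
    rintro x y p q n h r _ ⟨t, rfl⟩
    exact ⟨.act p q n h r t, rfl⟩

theorem mem_closureSub : y ∈ (closureSub w y).S x₀ n₀ := ⟨.gen, rfl⟩

theorem op_mem_closureSub {x : R.Obj} {i : ℤ} (s : Y.el x i) (hs : s ∈ (closureSub w y).S x i) :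
    w x i s ∈ (closureSub w y).S x (i + 1) := by
  obtain ⟨t, rfl⟩ := hs
  exact ⟨.op i t, rfl⟩

end

variable (R) in
/-- A bound for the size of the DG submodules generated by one element. -/
abbrev Terms : Type u := Σ (x₀ : R.Obj) (n₀ : ℤ) (x : R.Obj) (n : ℤ), Term R x₀ n₀ x n

/-- A DG module is bounded if it has at most as many elements as there are terms. -/
def IsBounded (M : DGModule R) : Prop :=
  ∀ x n, ∃ f : M.el x n → Terms R, Function.Injective f

theorem IsBounded.of_injective {M N : DGModule R} (h : IsBounded N) (φ : M ⟶ N)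
    (hφ : ∀ x n, Function.Injective (Hom.lin φ x n)) : IsBounded M := fun x n => by
  obtain ⟨f, hf⟩ := h x n
  exact ⟨_, hf.comp (hφ x n)⟩

/-- Choosing a term for each element is injective, and the terms depend neither on `Y` nor on the
operation `w`. -/
theorem isBounded_closureSub {Y : DGModule R} (w : ∀ x i, Y.el x i → Y.el x (i + 1))
    {x₀ : R.Obj} {n₀ : ℤ} (y : Y.el x₀ n₀) : IsBounded (closureSub w y).toModule := fun x n => by
  refine ⟨fun m => ⟨x₀, n₀, x, n, (m.2 : ∃ t, Term.eval w y t = _).choose⟩, fun m m' h => ?_⟩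
  have h' : (m.2 : ∃ t, Term.eval w y t = _).choose = (m'.2 : ∃ t, Term.eval w y t = _).choose := by
    simpa using h
  refine Subtype.ext ?_
  rw [← (m.2 : ∃ t, Term.eval w y t = _).choose_spec, h',
    (m'.2 : ∃ t, Term.eval w y t = _).choose_spec]

variable (R) in
/-- The free DG module of which every bounded DG module is a quotient. -/
noncomputable abbrev bigFree : DGModule R :=
  ∐ fun t : Σ (_ : R.Obj) (_ : ℤ), Terms R => free R t.1 (sub_add_cancel t.2.1 1)

theorem exists_bigFree_surjective (M : DGModule R) (hM : IsBounded M) :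
    ∃ q : bigFree R ⟶ M, ∀ x n, Function.Surjective (Hom.lin q x n) := by
  choose f hf using hM
  -- The generator labelled by a term goes to the element coded by it. Terms that code nothing go to
  -- a junk value, which does not affect surjectivity.
  refine ⟨Sigma.desc fun t => M.freeDesc (sub_add_cancel t.2.1 1)
    (Function.invFun (f t.1 t.2.1) t.2.2), fun x n m => ?_⟩
  refine ⟨Hom.lin (Sigma.ι (fun t : Σ (_ : R.Obj) (_ : ℤ), Terms R =>
    free R t.1 (sub_add_cancel t.2.1 1)) ⟨x, n, f x n m⟩) x n (freeUnit R x (sub_add_cancel n 1)), ?_⟩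
  rw [← Hom.lin_comp, Sigma.ι_desc, freeDesc_unit]
  exact Function.leftInverse_invFun (hf x n) m

variable (R) in
/-- The codes of bounded DG modules. -/
abbrev Code : Type u := ∀ x n, Set ((bigFree R).el x n)

theorem exists_code (M : DGModule R) (hM : IsBounded M) : ∃ c : Code R,
    ∃ q : bigFree R ⟶ M, (∀ x n, Function.Surjective (Hom.lin q x n)) ∧
      ∀ x n m, m ∈ c x n ↔ Hom.lin q x n m = 0 := by
  obtain ⟨q, hq⟩ := exists_bigFree_surjective M hM
  exact ⟨fun x n => {m | Hom.lin q x n m = 0}, q, hq, fun _ _ _ => Iff.rfl⟩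

variable (R) in
open Classical in
/-- A set of representatives of the bounded DG modules. -/
noncomputable def rep (c : Code R) : DGModule R :=
  if h : ∃ (M : DGModule R) (q : bigFree R ⟶ M), (∀ x n, Function.Surjective (Hom.lin q x n)) ∧
    ∀ x n m, m ∈ c x n ↔ Hom.lin q x n m = 0 then h.choose else zero R

/-- Quotients of `bigFree R` with equal kernels are isomorphic, so a bounded module is determined by
a family of subsets of `bigFree R`, and such families form a set. -/
theorem exists_iso_rep (M : DGModule R) (hM : IsBounded M) : ∃ c, Nonempty (M ≅ rep R c) := by
  obtain ⟨c, q, hq, h⟩ := exists_code M hM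
  have H : ∃ (M : DGModule R) (q : bigFree R ⟶ M), (∀ x n, Function.Surjective (Hom.lin q x n)) ∧
    ∀ x n m, m ∈ c x n ↔ Hom.lin q x n m = 0 := ⟨M, q, hq, h⟩
  have e : rep R c = H.choose := dif_pos H
  obtain ⟨q', hq', h'⟩ := H.choose_spec
  refine ⟨c, ?_⟩
  rw [e]
  obtain ⟨ψ, hψ⟩ := Hom.exists_desc q hq q' (fun x n m hm => (h' x n m).1 ((h x n m).2 hm))
  have : IsIso ψ := Hom.isIso_of_bijective ψ fun x n => ⟨by
    rw [injective_iff_map_eq_zero]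
    intro m hm
    obtain ⟨m, rfl⟩ := hq x n m
    rw [← Hom.lin_comp, hψ] at hm
    exact (h x n m).1 ((h' x n m).2 hm), fun m => by
    obtain ⟨m, rfl⟩ := hq' x n m
    exact ⟨Hom.lin q x n m, by rw [← Hom.lin_comp, hψ]⟩⟩
  exact ⟨asIso ψ⟩

variable (R) in
/-- A set of generating morphisms. -/
def generators (b : Prop) : MorphismProperty (DGModule R) :=
  MorphismProperty.ofHoms
    (fun z : {z : Σ c c' : Code R, rep R c ⟶ rep R c' // monoWith R b z.2.2} => z.1.2.2)

instance (b : Prop) : MorphismProperty.IsSmall.{u} (generators R b) := by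
  unfold generators
  infer_instance

theorem generators_le (b : Prop) : generators R b ≤ monoWith R b := by
  rintro _ _ _ ⟨z⟩
  exact z.2

theorem monoWith_eq_llp (b : Prop) : monoWith R b = (cofreeTests R b).llp :=
  le_antisymm (monoWith_le_llp b) (llp_le_monoWith b)

instance (b : Prop) : (monoWith R b).RespectsIso := by
  rw [monoWith_eq_llp]
  infer_instance

/-- Up to isomorphism of arrows, `generators R b` contains every member of `monoWith R b` between
bounded modules. -/
theorem hasLiftingProperty_of_isBounded {b : Prop} {A S E B : DGModule R} {i : A ⟶ S} {p : E ⟶ B}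
    (hA : IsBounded A) (hS : IsBounded S) (hi : monoWith R b i) (hp : (generators R b).rlp p) :
    HasLiftingProperty i p := by
  obtain ⟨c, ⟨e⟩⟩ := exists_iso_rep A hA
  obtain ⟨c', ⟨e'⟩⟩ := exists_iso_rep S hS
  let α : Arrow.mk i ≅ Arrow.mk (e.inv ≫ i ≫ e'.hom) := Arrow.isoMk e e' (by simp)
  have := hp _ (MorphismProperty.ofHoms.mk (f := fun z : {z : Σ c c' : Code R,
    rep R c ⟶ rep R c' // monoWith R b z.2.2} => z.1.2.2)
    ⟨⟨c, c', e.inv ≫ i ≫ e'.hom⟩, ((monoWith R b).arrow_mk_iso_iff α).1 hi⟩)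
  exact HasLiftingProperty.of_arrow_iso_left α.symm p

end DGModule

/-! ### Partial lifts and Zorn's lemma -/

namespace DGModule

variable {k : Type u} [CommRing k] {R : DGCat.{u} k}

namespace Sub

variable {M N : DGModule R}

instance : PartialOrder (Sub M) := PartialOrder.lift Sub.S (by rintro ⟨⟩ ⟨⟩ rfl; rfl)

/-- The intersection of two DG submodules. -/
def inf (S T : Sub M) : Sub M where
  S x n := S.S x n ⊓ T.S x n
  dl_mem x i j h m hm := ⟨S.dl_mem x i j h m hm.1, T.dl_mem x i j h m hm.2⟩
  act_mem p q n h r m hm := ⟨S.act_mem p q n h r m hm.1, T.act_mem p q n h r m hm.2⟩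

/-- The sum of two DG submodules. -/
def sup (S T : Sub M) : Sub M where
  S x n := S.S x n ⊔ T.S x n
  dl_mem x i j h m hm := by
    obtain ⟨s, hs, t, ht, rfl⟩ := Submodule.mem_sup.1 hm
    rw [map_add]
    exact Submodule.add_mem_sup (S.dl_mem x i j h s hs) (T.dl_mem x i j h t ht)
  act_mem p q n h r m hm := by
    obtain ⟨s, hs, t, ht, rfl⟩ := Submodule.mem_sup.1 hm
    rw [map_add]
    exact Submodule.add_mem_sup (S.act_mem p q n h r s hs) (T.act_mem p q n h r t ht)

/-- The range of a morphism. -/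
def range (φ : N ⟶ M) : Sub M where
  S x n := LinearMap.range (Hom.lin φ x n)
  dl_mem := by
    rintro x i j h _ ⟨m, rfl⟩
    exact ⟨_, Hom.lin_dl φ x i j m⟩
  act_mem := by
    rintro x y p q n h r _ ⟨m, rfl⟩
    exact ⟨_, Hom.lin_act φ p q n h r m⟩

/-- The union of a chain of DG submodules. -/
def iUnion (c : Set (Sub M)) : Sub M where
  S x n := ⨆ S : c, S.1.S x n
  dl_mem x i j h m hm := by
    refine (iSup_le (a := (⨆ S : c, S.1.S x j).comap (M.dl x i j)) fun S m hm => ?_) hm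
    exact Submodule.mem_iSup_of_mem S (S.1.dl_mem x i j h m hm)
  act_mem {x y} p q n h r m hm := by
    refine (iSup_le (a := (⨆ S : c, S.1.S y n).comap (M.act p q n h r)) fun S m hm => ?_) hm
    exact Submodule.mem_iSup_of_mem S (S.1.act_mem p q n h r m hm)

theorem mem_iUnion {c : Set (Sub M)} (hc : IsChain (· ≤ ·) c) (h₀ : c.Nonempty) {x : R.Obj} {n : ℤ}
    {m : M.el x n} : m ∈ (iUnion c).S x n ↔ ∃ S ∈ c, m ∈ S.S x n := by
  have : Nonempty c := h₀.to_subtype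
  have hd : Directed (· ≤ ·) fun S : c => S.1.S x n := fun S T => by
    obtain h | h := hc.total S.2 T.2
    · exact ⟨T, h x n, le_rfl⟩
    · exact ⟨S, le_rfl, h x n⟩
  refine (Submodule.mem_iSup_of_directed _ hd).trans ?_
  simp

end Sub

section

variable {X Y E B : DGModule R}

/-- The graphs of partial solutions of a lifting problem, defined on a DG submodule with acyclic
quotient if `b` holds. -/
structure IsPartialLift (b : Prop) (f : X ⟶ Y) (p : E ⟶ B) (u : X ⟶ E) (v : Y ⟶ B)
    (G : Sub (prod Y E)) : Prop where
  comm (x : R.Obj) (n : ℤ) (t) (ht : t ∈ G.S x n) :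
    Hom.lin p x n (Hom.lin (prodSnd Y E) x n t) = Hom.lin v x n (Hom.lin (prodFst Y E) x n t)
  func (x : R.Obj) (n : ℤ) (t) (ht : t ∈ G.S x n) (h : Hom.lin (prodFst Y E) x n t = 0) :
    Hom.lin (prodSnd Y E) x n t = 0
  base (x : R.Obj) (n : ℤ) (a : X.el x n) : Hom.lin (prodLift f u) x n a ∈ G.S x n
  acyclic (hb : b) (x : R.Obj) (j : ℤ) (y : Y.el x (j + 1)) (t) (ht : t ∈ G.S x j)
    (h : Hom.lin (prodFst Y E) x j t = Y.dl x (j + 1) j y) :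
    ∃ y' : Y.el x (j + 1 + 1), ∃ t' ∈ G.S x (j + 1),
      Hom.lin (prodFst Y E) x (j + 1) t' = y - Y.dl x (j + 1 + 1) (j + 1) y'

variable {b : Prop} {f : X ⟶ Y} {p : E ⟶ B} {u : X ⟶ E} {v : Y ⟶ B}

/-- The starting point: the graph of `u` regarded as a map on the image of `f`, whose cokernel is
acyclic if `b` holds. -/
theorem isPartialLift_range (hf : monoWith R b f) (sq : CommSq u f p v) :
    IsPartialLift b f p u v (Sub.range (prodLift f u)) where
  comm := by
    rintro x n _ ⟨a, rfl⟩
    exact congr(Hom.lin $(sq.w) x n a)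
  func := by
    rintro x n _ ⟨a, rfl⟩ h
    have : a = 0 := hf.1 x n (h.trans (map_zero _).symm)
    rw [this, map_zero, map_zero]
  base x n a := ⟨a, rfl⟩
  acyclic := by
    rintro hb x j y _ ⟨a, rfl⟩ h
    obtain ⟨m', y', rfl⟩ := hf.2 hb x (j + 1 + 1) (j + 1) j rfl rfl y a h.symm
    exact ⟨y', _, ⟨m', rfl⟩, (add_sub_cancel_right _ _).symm⟩

theorem isPartialLift_iUnion {c : Set (Sub (prod Y E))} (hc : IsChain (· ≤ ·) c) (h₀ : c.Nonempty)
    (h : ∀ G ∈ c, IsPartialLift b f p u v G) : IsPartialLift b f p u v (Sub.iUnion c) where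
  comm x n t ht := by
    obtain ⟨G, hG, ht⟩ := (Sub.mem_iUnion hc h₀).1 ht
    exact (h G hG).comm x n t ht
  func x n t ht h' := by
    obtain ⟨G, hG, ht⟩ := (Sub.mem_iUnion hc h₀).1 ht
    exact (h G hG).func x n t ht h'
  base x n a := by
    obtain ⟨G, hG⟩ := id h₀
    exact (Sub.mem_iUnion hc h₀).2 ⟨G, hG, (h G hG).base x n a⟩
  acyclic hb x j y t ht h' := by
    obtain ⟨G, hG, ht⟩ := (Sub.mem_iUnion hc h₀).1 ht
    obtain ⟨y', t', ht', e⟩ := (h G hG).acyclic hb x j y t ht h'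
    exact ⟨y', t', (Sub.mem_iUnion hc h₀).2 ⟨G, hG, ht'⟩, e⟩

/-- Let `D` be the domain of `G` and `S` the closure of `y₀` under the module operations and a
choice of primitives modulo `D`. Then `S ∩ D → S` belongs to `monoWith R b` and `S` is bounded, so
the partial lift extends from `S ∩ D` to `S` and glues to `D + S`. If `b` holds, `Y / (D + S)` stays
acyclic because `Y / D` and `(D + S) / D = S / (S ∩ D)` are. -/
theorem IsPartialLift.exists_extension {G : Sub (prod Y E)} (hG : IsPartialLift b f p u v G)
    (hp : (generators R b).rlp p) {x₀ : R.Obj} {n₀ : ℤ} (y₀ : Y.el x₀ n₀) :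
    ∃ G', G ≤ G' ∧ IsPartialLift b f p u v G' ∧
      ∃ t ∈ G'.S x₀ n₀, Hom.lin (prodFst Y E) x₀ n₀ t = y₀ := by
  -- If `ds` lies in `D`, then `s - d (w s)` lies in `D`; elsewhere `w` takes the value `0`. Closure
  -- of `S` under `w` makes `S / (S ∩ D)` acyclic.
  have hw (x i) (s : Y.el x i) : ∃ s' : Y.el x (i + 1), b → ∀ l, l + 1 = i →
      (∃ t ∈ G.S x l, Hom.lin (prodFst Y E) x l t = Y.dl x i l s) →
      ∃ t' ∈ G.S x i, Hom.lin (prodFst Y E) x i t' = s - Y.dl x (i + 1) i s' := by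
    by_cases h : b ∧ ∃ l, l + 1 = i ∧ ∃ t ∈ G.S x l, Hom.lin (prodFst Y E) x l t = Y.dl x i l s
    · obtain ⟨hb, l, rfl, t, ht, e⟩ := h
      obtain ⟨y', h⟩ := hG.acyclic hb x l s t ht e
      exact ⟨y', fun _ _ _ _ => h⟩
    · exact ⟨0, fun hb l hl h' => (h ⟨hb, l, hl, h'⟩).elim⟩
  choose w hw using hw
  let S := closureSub w y₀
  -- The part of the graph `G` over `S`; its first projection identifies it with `S ∩ D`.
  let A := G.inf (S.comap (prodFst Y E))
  let i : A.toModule ⟶ S.toModule := Sub.lift (A.incl ≫ prodFst Y E) fun x n m => m.2.2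
  have hi (x n m) : Hom.lin S.incl x n (Hom.lin i x n m) =
    Hom.lin (prodFst Y E) x n (Hom.lin A.incl x n m) := rfl
  have hi₁ (x n) : Function.Injective (Hom.lin i x n) := by
    rw [injective_iff_map_eq_zero]
    intro m hm
    have hm' : Hom.lin (prodFst Y E) x n (Hom.lin A.incl x n m) = 0 := by
      rw [← hi, hm, map_zero]
    refine A.incl_injective x n (prod_ext ?_ ?_)
    · rw [hm', map_zero, map_zero]
    · rw [(hG.func x n _ m.2.1 hm' : Hom.lin (prodSnd Y E) x n (Hom.lin A.incl x n m) = 0),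
        map_zero, map_zero]
  have hi₂ : monoWith R b i := ⟨hi₁, fun hb x i' j l hi' hl s m hs => by
    subst hi'
    have hs' : Hom.lin (prodFst Y E) x l (Hom.lin A.incl x l m) =
        Y.dl x j l (Hom.lin S.incl x j s) := by
      rw [← hi, ← hs, Hom.lin_dl]
    obtain ⟨t, ht, e⟩ := hw x j (Hom.lin S.incl x j s) hb l hl ⟨_, m.2.1, hs'⟩
    obtain ⟨s', hs'⟩ := S.exists_incl x (j + 1) _ (op_mem_closureSub w y₀ _ (S.incl_mem x j s))
    have ht' : t ∈ (S.comap (prodFst Y E)).S x j := by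
      rw [Sub.comap, Submodule.mem_comap, e]
      exact sub_mem (S.incl_mem x j s)
        (S.dl_mem x _ _ rfl _ (op_mem_closureSub w y₀ _ (S.incl_mem x j s)))
    obtain ⟨m', rfl⟩ := A.exists_incl x j t ⟨ht, ht'⟩
    refine ⟨m', s', S.incl_injective x j ?_⟩
    rw [map_add, hi, e, Hom.lin_dl, hs', sub_add_cancel]⟩
  have hS : IsBounded S.toModule := isBounded_closureSub w y₀
  have := hasLiftingProperty_of_isBounded (hS.of_injective i hi₁) hS hi₂ hp
  have sq : CommSq (A.incl ≫ prodSnd Y E) i p (S.incl ≫ v) :=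
    ⟨Hom.lin_ext fun x n m => hG.comm x n _ m.2.1⟩
  have h₁ (x n m) : Hom.lin sq.lift x n (Hom.lin i x n m) =
    Hom.lin (prodSnd Y E) x n (Hom.lin A.incl x n m) := congr(Hom.lin $(sq.fac_left) x n m)
  have h₂ (x n s) : Hom.lin p x n (Hom.lin sq.lift x n s) = Hom.lin v x n (Hom.lin S.incl x n s) :=
    congr(Hom.lin $(sq.fac_right) x n s)
  let g := prodLift S.incl sq.lift
  have g₁ (x n s) : Hom.lin (prodFst Y E) x n (Hom.lin g x n s) = Hom.lin S.incl x n s := rfl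
  have g₂ (x n s) : Hom.lin (prodSnd Y E) x n (Hom.lin g x n s) = Hom.lin sq.lift x n s := rfl
  refine ⟨G.sup (Sub.range g), fun x n => le_sup_left, ⟨?_, ?_, ?_, ?_⟩, ?_⟩
  · intro x n t₀ ht₀
    obtain ⟨t, ht, _, ⟨s, rfl⟩, rfl⟩ := Submodule.mem_sup.1 ht₀
    rw [map_add, map_add, map_add, map_add, hG.comm x n t ht, g₁, g₂, h₂]
  · intro x n t₀ ht₀ h
    obtain ⟨t, ht, _, ⟨s, rfl⟩, rfl⟩ := Submodule.mem_sup.1 ht₀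
    rw [map_add, g₁] at h
    -- Single-valuedness: if `t` and `g s` have opposite first components, these lie in `S ∩ D`,
    -- where the old and new lifts agree.
    have ht' : t ∈ (S.comap (prodFst Y E)).S x n := by
      rw [Sub.comap, Submodule.mem_comap, eq_neg_of_add_eq_zero_left h]
      exact neg_mem (S.incl_mem x n s)
    obtain ⟨m, rfl⟩ := A.exists_incl x n t ⟨ht, ht'⟩
    have hm : Hom.lin i x n m + s = 0 := S.incl_injective x n (by rw [map_add, hi, h, map_zero])
    rw [map_add, g₂, ← h₁, ← map_add, hm, map_zero]
  · exact fun x n a => Submodule.mem_sup_left (hG.base x n a)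
  · intro hb x j y t₀ ht₀ h
    obtain ⟨t, ht, _, ⟨s, rfl⟩, rfl⟩ := Submodule.mem_sup.1 ht₀
    rw [map_add, g₁] at h
    obtain ⟨l, rfl⟩ : ∃ l, l + 1 = j := ⟨j - 1, by omega⟩
    -- Write `τ` for the first component of `t`, so `τ + s = dy`. Then `ds = -dτ` lies in `D`, so
    -- `w` gives `s'` with `s - ds'` in `D`. Now `d (y - s')` lies in `D`, and acyclicity for `G`
    -- applies to `y - s'`.
    obtain ⟨t', ht', e⟩ := hw x (l + 1) (Hom.lin S.incl x _ s) hb l rfl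
      ⟨(prod Y E).dl x (l + 1) l (-t), G.dl_mem x _ _ rfl _ (neg_mem ht), by
        rw [Hom.lin_dl, map_neg, eq_sub_of_add_eq h, neg_sub, map_sub, dl_dl, sub_zero]⟩
    obtain ⟨s', hs'⟩ := S.exists_incl x (l + 1 + 1) _
      (op_mem_closureSub w y₀ _ (S.incl_mem x (l + 1) s))
    rw [← hs'] at e
    obtain ⟨y', t'', ht'', e'⟩ := hG.acyclic hb x (l + 1) (y - Hom.lin S.incl x _ s') (t + t')
      (add_mem ht ht') (by rw [map_add, e, map_sub, ← h]; abel)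
    refine ⟨y', t'' + Hom.lin g x _ s', Submodule.add_mem_sup ht'' ⟨s', rfl⟩, ?_⟩
    rw [map_add, e', g₁]
    abel
  · obtain ⟨s, hs⟩ := S.exists_incl x₀ n₀ y₀ (mem_closureSub w y₀)
    exact ⟨_, Submodule.mem_sup_right ⟨s, rfl⟩, hs⟩

/-- A graph defined on all of `Y` projects isomorphically to `Y`; the lift is the inverse followed
by the second projection. -/
theorem IsPartialLift.hasLift {G : Sub (prod Y E)} (hG : IsPartialLift b f p u v G)
    (hG' : ∀ x n y, ∃ t ∈ G.S x n, Hom.lin (prodFst Y E) x n t = y) :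
    ∃ l : Y ⟶ E, f ≫ l = u ∧ l ≫ p = v := by
  let q : G.toModule ⟶ Y := G.incl ≫ prodFst Y E
  have : IsIso q := Hom.isIso_of_bijective q fun x n => ⟨by
    rw [injective_iff_map_eq_zero]
    intro m hm
    exact G.incl_injective x n (prod_ext (hm.trans (by simp))
      ((hG.func x n _ m.2 hm).trans (by simp))), fun y => by
    obtain ⟨t, ht, rfl⟩ := hG' x n y
    exact ⟨⟨t, ht⟩, rfl⟩⟩
  let f' : X ⟶ G.toModule := Sub.lift (prodLift f u) hG.base
  have hf : f = f' ≫ q := rfl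
  refine ⟨inv q ≫ G.incl ≫ prodSnd Y E, ?_, ?_⟩
  · rw [hf, Category.assoc, IsIso.hom_inv_id_assoc]
    rfl
  · rw [Category.assoc, IsIso.inv_comp_eq]
    exact Hom.lin_ext fun x n m => hG.comm x n _ m.2

/-- Zorn gives a maximal partial lift. It is defined everywhere, since otherwise it could be
extended by a missing element. -/
theorem rlp_generators (b : Prop) : (generators R b).rlp = (monoWith R b).rlp := by
  refine le_antisymm (fun E B p hp X Y f hf => ⟨fun {u v} sq => ?_⟩)
    (MorphismProperty.antitone_rlp (generators_le b))
  obtain ⟨G, -, hG⟩ := zorn_le_nonempty₀ {G | IsPartialLift b f p u v G}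
    (fun c hc hc' G₀ hG₀ => ⟨Sub.iUnion c,
      isPartialLift_iUnion hc' ⟨G₀, hG₀⟩ (fun G hG => hc hG),
      fun G hG x n m hm => (Sub.mem_iUnion hc' ⟨G₀, hG₀⟩).2 ⟨G, hG, hm⟩⟩)
    _ (isPartialLift_range hf sq)
  obtain ⟨l, h₁, h₂⟩ := IsPartialLift.hasLift hG.1 fun x n y => by
    obtain ⟨G', h, hG', t, ht, e⟩ := IsPartialLift.exists_extension hG.1 hp y
    exact ⟨t, hG.2 hG' h x n ht, e⟩
  exact ⟨⟨⟨l, h₁, h₂⟩⟩⟩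

end

end DGModule

/-! ### Small object argument and the model structure -/

namespace DGModule

variable {k : Type u} [CommRing k] {R : DGCat.{u} k}

/-- In a locally presentable category each object is presentable for some cardinal. The codes form a
set, so one regular cardinal exceeds all those required. -/
theorem exists_cardinal_rep (R : DGCat.{u} k) : ∃ (κ : Cardinal.{u}) (_ : Fact κ.IsRegular),
    ∀ c, IsCardinalPresentable (rep R c) κ := by
  have h (c : Code R) : ∃ (κ : Cardinal.{u}) (_ : Fact κ.IsRegular),
      IsCardinalPresentable (rep R c) κ :=
    Functor.IsAccessible.exists_cardinal (F := coyoneda.obj (Opposite.op (rep R c)))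
  choose κ hκ h using h
  obtain ⟨κ', hκ', hlt⟩ := HasCardinalLT.exists_regular_cardinal_forall.{u} fun c => (κ c).out
  refine ⟨κ', ⟨hκ'⟩, fun c => ?_⟩
  have : Fact κ'.IsRegular := ⟨hκ'⟩
  refine isCardinalPresentable_of_le (rep R c) (κ := κ c) (le_of_lt ?_)
  have := hlt c
  rw [hasCardinalLT_iff_cardinal_mk_lt, Cardinal.mk_out] at this
  exact this

instance (b : Prop) : MorphismProperty.HasSmallObjectArgument.{u} (generators R b) := by
  obtain ⟨κ, hκ, h⟩ := exists_cardinal_rep R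
  have : Nonempty κ.ord.ToType := by simpa using hκ.out.ne_zero
  have := WellFoundedLT.toOrderBot κ.ord.ToType
  refine ⟨κ, inferInstance, inferInstance, { preservesColimit := ?_ }⟩
  rintro _ _ _ _ _ ⟨⟨⟨c, c', i⟩, hi⟩⟩ f hf
  have := h c
  have := preservesColimitsOfShape_of_isCardinalPresentable (rep R c) κ κ.ord.ToType
  infer_instance

/-- The cofree tests bound the maps cofibrantly generated by `generators R b` from above; the
equality of right orthogonals gives the other inclusion. -/
theorem monoWith_rlp_llp (b : Prop) : (monoWith R b).rlp.llp = monoWith R b := by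
  rw [← rlp_generators]
  refine le_antisymm (llp_rlp_le_monoWith (generators_le b)) ?_
  rw [rlp_generators]
  exact MorphismProperty.le_llp_rlp _

instance (b : Prop) :
    MorphismProperty.IsWeakFactorizationSystem (monoWith R b) (monoWith R b).rlp where
  rlp := rfl
  llp := monoWith_rlp_llp b
  hasFactorization := by
    -- The small object argument for the generating set, whose orthogonals are those of `monoWith R
    -- b`.
    have : MorphismProperty.HasFunctorialFactorization (generators R b).rlp.llp
      (generators R b).rlp := inferInstance
    rw [rlp_generators, monoWith_rlp_llp] at this
    infer_instance

/-- A cycle `e` with `p e = db` is a square from `sphereToFree` to `p`. A lift is an `e'` with `de'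
= e` and `p e' = b`, which yields both halves of the quasi-isomorphism criterion. -/
theorem objectwiseQuasiIso_of_rlp {E B : DGModule R} (p : E ⟶ B) (hp : (monoWith R False).rlp p) :
    objectwiseQuasiIso R p := by
  refine objectwiseQuasiIso_of_lift p fun x i j hij e b he hb => ?_
  have := hp (sphereToFree R x hij) ⟨sphereToFree_injective hij, False.elim⟩
  have sq : CommSq (E.sphereDesc e he) (sphereToFree R x hij) p (B.freeDesc hij b) :=
    ⟨sphere_hom_ext (by
      rw [Hom.lin_comp, Hom.lin_comp, sphereDesc_unit, sphereToFree_unit, Hom.lin_dl,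
        freeDesc_unit, hb])⟩
  refine ⟨Hom.lin sq.lift x i (freeUnit R x hij), ?_, ?_⟩
  · rw [← Hom.lin_dl, ← sphereToFree_unit, ← Hom.lin_comp, sq.fac_left, sphereDesc_unit]
  · rw [← Hom.lin_comp, sq.fac_right, freeDesc_unit]

/-- For the reverse inclusion, factor `p` as a monomorphism followed by a map with the right lifting
property against monomorphisms. Two-out-of-three makes the first factor a trivial cofibration; `p`
lifts against it and is a retract of the second factor. -/
theorem rlp_monomorphisms :
    (monoWith R False).rlp = (monoWith R True).rlp ⊓ objectwiseQuasiIso R := by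
  refine le_antisymm (le_inf (MorphismProperty.antitone_rlp fun _ _ _ h => ⟨h.1, False.elim⟩)
    fun _ _ p hp => objectwiseQuasiIso_of_rlp p hp) ?_
  rintro E B p ⟨hp, hp'⟩
  let F := MorphismProperty.factorizationData (monoWith R False) (monoWith R False).rlp p
  have hi : monoWith R True F.i := by
    rw [monoWith_true, ← monoWith_false]
    refine ⟨F.hi, ?_⟩
    refine MorphismProperty.of_postcomp _ F.i F.p (objectwiseQuasiIso_of_rlp F.p F.hp) ?_
    rwa [F.fac]
  have := hp F.i hi
  exact MorphismProperty.of_retract (RetractArrow.ofRightLiftingProperty F.fac) F.hp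

end DGModule

theorem mainTheorem11 {k : Type u} [CommRing k] (R : DGCat.{u} k) :
    ∃ m : ModelCategory (DGModule R),
      weakEquivalences (DGModule R) = DGModule.objectwiseQuasiIso R ∧
      cofibrations (DGModule R) = MorphismProperty.monomorphisms (DGModule R) ∧
      IsCombinatorial.{u, u + 1, u} (DGModule R) := by
  let _ : CategoryWithFibrations (DGModule R) := ⟨(DGModule.monoWith R True).rlp⟩
  let _ : CategoryWithCofibrations (DGModule R) := ⟨MorphismProperty.monomorphisms (DGModule R)⟩
  let _ : CategoryWithWeakEquivalences (DGModule R) := ⟨DGModule.objectwiseQuasiIso R⟩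
  have h₁ : cofibrations (DGModule R) = DGModule.monoWith R False := DGModule.monoWith_false.symm
  have h₂ : trivialFibrations (DGModule R) = (DGModule.monoWith R False).rlp :=
    DGModule.rlp_monomorphisms.symm
  have h₃ : trivialCofibrations (DGModule R) = DGModule.monoWith R True :=
    DGModule.monoWith_true.symm
  have h₄ : fibrations (DGModule R) = (DGModule.monoWith R True).rlp := rfl
  have : (weakEquivalences (DGModule R)).HasTwoOutOfThreeProperty :=
    inferInstanceAs (DGModule.objectwiseQuasiIso R).HasTwoOutOfThreeProperty
  have : MorphismProperty.IsWeakFactorizationSystem (cofibrations (DGModule R))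
      (trivialFibrations (DGModule R)) := by
    rw [h₁, h₂]
    infer_instance
  have : MorphismProperty.IsWeakFactorizationSystem (trivialCofibrations (DGModule R))
      (fibrations (DGModule R)) := by
    rw [h₃, h₄]
    infer_instance
  exact ⟨ModelCategory.mk' _, rfl, rfl,
    ⟨DGModule.generators R False, DGModule.generators R True, inferInstance, inferInstance,
      inferInstance, inferInstance, h₂.trans (DGModule.rlp_generators _).symm,
      h₄.trans (DGModule.rlp_generators _).symm⟩, inferInstance⟩
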